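/- The following is provable in $\mathsf{RCA}_0$, i.e. (by Gödel's completeness theorem) holds in every structure $(M,\mathcal S,0,1,+,\cdot,<)$ for second-order arithmetic, $\mathcal S\subseteq\mathcal P(M)$, that satisfies the axioms of a commutative discrete ordered semiring, $\Sigma^0_1$ induction and $\Delta^0_1$ comprehension (schemes with number and set parameters). Here $\mathbb N$ denotes the range $M$ of the number variables, all sets and functions are elements of $\mathcal S$ or formulas of the structure, "finite set" means bounded set, and finite sets and finite sequences are coded by numbers in the usual way, with the pairing $(a,b)=(a+b)^2+a$ and with the finite set $\{i<k : m(i+1)+1 \mid n\}$ coded by the least number $(k,(m,n))$ that gives this set. **Definitions.** A *weak order* on $X$ is a transitive, strongly connected relation $R\subseteq X\times X$; $x\lesssim_R y$ means $(x,y)\in R$ and $x<_R y$ means $(x,y)\in R$, $(y,x)\notin R$. A *countable society* $\langle V,X,\mathcal A,\mathcal F\rangle$ consists of a nonempty set $V\subseteq\mathbb N$ (voters), a finite set $X\subseteq\mathbb N$ with $|X|\ge 3$ (alternatives; $W$ is the set of codes of weak orders on $X$), a sequence $\mathcal A=\langle A_i:i\in\mathbb N\rangle$ of subsets of $V$ and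 a sequence $\mathcal F=\langle f_i:i\in\mathbb N\rangle$ of functions $f_i:V\to W$ (profiles), such that: * $V$ is one of the $A_i$, the family of the $A_i$ is closed under (binary) unions and intersections and under complements relative to $V$, and every $\{v\}$ with $v\in V$ is one of the $A_i$; * (uniform measurability) there is $\mu:\mathbb N\times X\times X\to\mathbb N$ with $x\lesssim_{f_n(v)}y\leftrightarrow v\in A_{\mu(n,x,y)}$ for all $n$, $x,y\in X$, $v\in V$; * (quasi-partition embedding) there is a function $e$, defined on all pairs $(p,s)$ where $p$ is a permutation of $W$ (a finite sequence of elements of $W$ in which each element of $W$ occurs exactly once) and $s$ is a finite sequence of numbers of length $1\le \mathrm{lh}(s)\le |W|$, with values in $\mathbb N$, such that for all $v\in V$: $f_{e(p,s)}(v)=p(i)$ if $i$ is the unique $i<\mathrm{lh}(s)-1$ with $v\in A_{s(i)}$, and $f_{e(p,s)}(v)=p(\mathrm{lh}(s)-1)$ if there is no such unique $i$. A *social welfare function* is a function $\sigma:\mathbb N\to W$ such that for all $x,y\in X$ and all $i,j$: (unanimity) if $x<_{f_i(v)}y$ for all $v\in V$, then $x<_{\sigma(i)}y$; (independence) if $f_i(v)$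 and $f_j(v)$ agree on $\{x,y\}$ for all $v\in V$, then $\sigma(i)$ and $\sigma(j)$ agree on $\{x,y\}$. **Lemma.** Let $\langle V,X,\mathcal A,\mathcal F\rangle$ be a countable society and $\sigma$ a social welfare function for it. Then the following are equivalent. 1. $\sigma$ is *non-dictatorial*: for every $v\in V$ there are $i\in\mathbb N$ and $x,y\in X$ with $x<_{f_i(v)}y$ and $y\lesssim_{\sigma(i)}x$. 2. $\sigma$ is $k$-*non-dictatorial* for some $k\ge 1$, where $k$-non-dictatorial means: for every finite sequence $s$ of voters of length $\mathrm{lh}(s)\le k$ there are $j\in\mathbb N$ and $x,y\in X$ such that $x<_{f_j(s(i))}y$ for all $i<\mathrm{lh}(s)$, and $y<_{\sigma(j)}x$. 3. $\sigma$ is *finitely non-dictatorial*: it is $k$-non-dictatorial for all $k\ge 1$. 4. $\sigma$ has the *cofinite coalitions property*: for every $j\in\mathbb N$ and all $x,y\in X$, if $x<_{f_j(v)}y$ for all but finitely many $v\in V$, then $x<_{\sigma(j)}y$. -/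

import Mathlib

/-!
# Second-order arithmetic, `RCA₀`, and countable societies inside a model of `RCA₀`

A structure for the language of second-order arithmetic is `(M, 𝒮, 0, 1, +, ·, <)`, where `M` is
the (possibly nonstandard) range of the number variables and `𝒮 ⊆ 𝒫(M)` is the range of the set
variables.  By Gödel's completeness theorem, a sentence is provable in `RCA₀` if and only if it
holds in every such structure that satisfies the axioms of `RCA₀`.

All the notions of social choice below are the satisfaction in `(M, 𝒮)` of formulas of
second-order arithmetic: every number quantifier ranges over `M`, every set whose existence
is claimed is an element of `𝒮`, and finiteness, finite sequences and their lengths are those of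
the structure, through the usual codes.
-/

namespace RevMath

universe u

/-! ### Bounded formulas with parameters, and `RCA₀` -/

/-- Number terms with parameters from `M` (among them `0` and `1`).  The variable `var i` is a
de Bruijn index. -/
inductive NumTerm (M : Type u) : Type u
  | var : ℕ → NumTerm M
  | param : M → NumTerm M
  | add : NumTerm M → NumTerm M → NumTerm M
  | mul : NumTerm M → NumTerm M → NumTerm M

/-- The value of a term under an assignment of the number variables. -/
def NumTerm.val {M : Type u} [CommSemiring M] (e : ℕ → M) : NumTerm M → M
  | .var i => e i
  | .param a => a
  | .add t s => t.val e + s.val e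
  | .mul t s => t.val e * s.val e

/-- The assignment that gives the value `a` to the variable `0` and shifts the others. -/
def cons {M : Type u} (a : M) (e : ℕ → M) : ℕ → M
  | 0 => a
  | i + 1 => e i

/-- Formulas of second-order arithmetic all of whose quantifiers are bounded number quantifiers,
with number parameters from `M` and set parameters from `𝒮`.  (The other connectives and the
bounded existential quantifier are definable from these.) -/
inductive BddFormula {M : Type u} (𝒮 : Set (Set M)) : Type u
  | eq : NumTerm M → NumTerm M → BddFormula 𝒮
  | lt : NumTerm M → NumTerm M → BddFormula 𝒮
  | mem : NumTerm M → 𝒮 → BddFormula 𝒮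
  | not : BddFormula 𝒮 → BddFormula 𝒮
  | and : BddFormula 𝒮 → BddFormula 𝒮 → BddFormula 𝒮
  | ballLT : NumTerm M → BddFormula 𝒮 → BddFormula 𝒮

/-- Satisfaction of bounded formulas; `ballLT t φ` is `∀ x < t, φ`, where `x` is the variable `0`
of `φ`, and the variable `i + 1` of `φ` is the outer variable `i`. -/
def BddFormula.Holds {M : Type u} [CommSemiring M] [LinearOrder M] {𝒮 : Set (Set M)} :
    (ℕ → M) → BddFormula 𝒮 → Prop
  | e, .eq t s => t.val e = s.val e
  | e, .lt t s => t.val e < s.val e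
  | e, .mem t Y => t.val e ∈ (Y : Set M)
  | e, .not φ => ¬ φ.Holds e
  | e, .and φ ψ => φ.Holds e ∧ ψ.Holds e
  | e, .ballLT t φ => ∀ a : M, a < t.val e → φ.Holds (cons a e)

/-- `θ(n, k)`: the variable `0` is `k`, the variable `1` is `n`.  Other free variables are not
needed, as parameters are allowed. -/
def BddFormula.Holds₂ {M : Type u} [CommSemiring M] [LinearOrder M] {𝒮 : Set (Set M)}
    (θ : BddFormula 𝒮) (n k : M) : Prop :=
  θ.Holds (cons k (cons n (fun _ => 0)))

/-- `(M, 𝒮)` is a model of `RCA₀`.  The basic axioms, those of a commutative discrete ordered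
semiring, are the type class assumptions (a linearly ordered commutative semiring with strictly
monotone operations in which `a ≤ b` if and only if `b = a + c` for some `c`) together with
`discrete`.  The two schemes are stated with parameters, which amounts to taking universal
closures. -/
structure IsModelRCA₀ {M : Type u} [CommSemiring M] [LinearOrder M] [IsStrictOrderedRing M]
    [CanonicallyOrderedAdd M] (𝒮 : Set (Set M)) : Prop where
  discrete : ∀ a : M, 0 < a → 1 ≤ a
  sigma_one_induction : ∀ θ : BddFormula 𝒮,
    (∃ k, θ.Holds₂ 0 k) → (∀ n, (∃ k, θ.Holds₂ n k) → ∃ k, θ.Holds₂ (n + 1) k) →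
      ∀ n, ∃ k, θ.Holds₂ n k
  delta_one_comprehension : ∀ θ η : BddFormula 𝒮,
    (∀ n, (∃ k, θ.Holds₂ n k) ↔ ∀ k, η.Holds₂ n k) →
      ∃ Y ∈ 𝒮, ∀ n, n ∈ Y ↔ ∃ k, θ.Holds₂ n k

section Coding

variable {M : Type u} [CommSemiring M]

/-! ### Pairs, sequences of sets, functions -/

/-- The pairing map `(a, b) = (a + b)² + a`. -/
def pair (a b : M) : M := (a + b) ^ 2 + a

/-- The `i`-th set `Y_i = {v : (i, v) ∈ Y}` of the sequence of sets coded by `Y`. -/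
def row (Y : Set M) (i : M) : Set M := {v | pair i v ∈ Y}

/-- `f`, as a set of pairs, is a function from `A` to `B`. -/
def IsFun (f A B : Set M) : Prop :=
  (∀ c ∈ f, ∃ a ∈ A, ∃ b ∈ B, c = pair a b) ∧ ∀ a ∈ A, ∃! b, pair a b ∈ f

variable [LinearOrder M]

/-- A set of numbers is finite, in the sense of second-order arithmetic, if it is bounded. -/
def IsFinite (Y : Set M) : Prop := ∃ b, ∀ y ∈ Y, y < b

/-! ### Codes of finite sets and of finite sequences -/

/-- `i` is an element of the finite set coded by `c = (k, (m, n))`, namely of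
`{i < k : m (i + 1) + 1 divides n}`. -/
def InCode (i c : M) : Prop :=
  ∃ k m n, c = pair k (pair m n) ∧ i < k ∧ (m * (i + 1) + 1) ∣ n

/-- `c` is the code of a finite set: the least number that codes this set.  (The code of the empty
set is `0 = (0, (0, 0))`, so numbers that are not of the form `(k, (m, n))` are not codes.) -/
def IsFinCode (c : M) : Prop := ∀ d < c, ¬ ∀ i, InCode i d ↔ InCode i c

/-- `s(i) = a` for the finite sequence coded by `s`. -/
def Entry (s i a : M) : Prop := InCode (pair i a) s

/-- `s ∈ Seq` and `lh(s) = l`: `s` is the code of a finite set of pairs that is a function with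
domain `{i : i < l}`. -/
def IsSeq (s l : M) : Prop :=
  IsFinCode s ∧ (∀ c, InCode c s → ∃ i a, c = pair i a) ∧
    (∀ i a b, Entry s i a → Entry s i b → a = b) ∧ ∀ i, i < l ↔ ∃ a, Entry s i a

/-! ### Weak orders, profiles -/

/-- `(x, y)` belongs to the relation coded by `r`, i.e. `x ≲_r y`. -/
def CodeLE (r x y : M) : Prop := InCode (pair x y) r

/-- `x <_r y`. -/
def CodeLT (r x y : M) : Prop := CodeLE r x y ∧ ¬ CodeLE r y x

/-- The set `W` of all codes of weak orders on `X`. -/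
def weakOrders (X : Set M) : Set M :=
  {r | IsFinCode r ∧ (∀ c, InCode c r → ∃ x ∈ X, ∃ y ∈ X, c = pair x y) ∧
    (∀ x ∈ X, ∀ y ∈ X, ∀ z ∈ X, CodeLE r x y → CodeLE r y z → CodeLE r x z) ∧
    ∀ x ∈ X, ∀ y ∈ X, CodeLE r x y ∨ CodeLE r y x}

/-- `x ≲_{f(a)} y`, for a function `f` with values in the weak orders.  With `f` the profile
`f_i = row F i` and `a = v` a voter this is `x ≲_{i(v)} y`; with `f = σ` a social welfare function
and `a = i` (the index of) a profile this is `x ≲_{σ(i)} y`. -/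
def PrefLE (f : Set M) (a x y : M) : Prop := ∃ r, pair a r ∈ f ∧ CodeLE r x y

/-- `x <_{f(a)} y`. -/
def PrefLT (f : Set M) (a x y : M) : Prop := ∃ r, pair a r ∈ f ∧ CodeLT r x y

/-- `F = ⟨f_i⟩` is a sequence of profiles `f_i : V → W` over `V`, `X`. -/
def IsProfileSeq (V X F : Set M) : Prop := ∀ i, IsFun (row F i) V (weakOrders X)

/-! ### Countable algebras and countable societies -/

/-- `A = ⟨A_i⟩` is a countable algebra over `V`. -/
structure IsCountableAlgebra (V A : Set M) : Prop where
  subset : ∀ i, row A i ⊆ V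
  whole : ∃ k, row A k = V
  union : ∀ i j, ∃ k, row A k = row A i ∪ row A j
  inter : ∀ i j, ∃ k, row A k = row A i ∩ row A j
  compl : ∀ i, ∃ k, row A k = V \ row A i

/-- The algebra `A = ⟨A_i⟩` over `V` is atomic. -/
def IsAtomic (V A : Set M) : Prop := ∀ v ∈ V, ∃ k, row A k = {v}

/-- `F` is uniformly `A`-measurable: some `μ : ℕ × X × X → ℕ` in `𝒮` satisfies
`x ≲_{n(v)} y ↔ v ∈ A_{μ(n, x, y)}`. -/
def UniformlyMeasurable (𝒮 : Set (Set M)) (V X A F : Set M) : Prop :=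
  ∃ μ ∈ 𝒮, IsFun μ {c | ∃ n, ∃ x ∈ X, ∃ y ∈ X, c = pair n (pair x y)} Set.univ ∧
    ∀ n, ∀ x ∈ X, ∀ y ∈ X, ∀ v ∈ V, ∀ k, pair (pair n (pair x y)) k ∈ μ →
      (PrefLE (row F n) v x y ↔ v ∈ row A k)

/-- `p ∈ Perm(W)`, and its length (which is the cardinality `|W|`) is `l`: every entry of `p` is
in `W`, and every element of `W` occurs exactly once. -/
def IsPerm (W : Set M) (p l : M) : Prop :=
  IsSeq p l ∧ (∀ i r, Entry p i r → r ∈ W) ∧ ∀ r ∈ W, ∃! i, Entry p i r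

/-- `p ∈ Perm(W)`, and `s` is a quasi-partition of length `t + 1 ≤ |W|`. -/
def IsPermQPart (W : Set M) (p s t : M) : Prop :=
  ∃ l, IsPerm W p l ∧ IsSeq s (t + 1) ∧ t + 1 ≤ l

/-- `v ∈ A_{s(i)}`. -/
def InNth (A : Set M) (s i v : M) : Prop := ∃ a, Entry s i a ∧ v ∈ row A a

/-- `f(v) = p(i)`. -/
def TakesEntry (f : Set M) (v p i : M) : Prop := ∃ r, Entry p i r ∧ pair v r ∈ f

/-- `A` is quasi-partition embedded into `F`: there is a function
`e : Perm(W) × QPart(|W|) → ℕ` in `𝒮` such that, for `lh(s) = t + 1` and `v ∈ V`, the value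
`f_{e(p,s)}(v)` is `p(i)` if `i` is the unique `i < t` with `v ∈ A_{s(i)}`, and is `p(t)` if there
is no such unique `i`. -/
def QuasiPartitionEmbedded (𝒮 : Set (Set M)) (V X A F : Set M) : Prop :=
  ∃ e ∈ 𝒮,
    IsFun e {c | ∃ p s t, IsPermQPart (weakOrders X) p s t ∧ c = pair p s} Set.univ ∧
    ∀ p s t n, IsPermQPart (weakOrders X) p s t → pair (pair p s) n ∈ e → ∀ v ∈ V,
      (∀ i, i < t → InNth A s i v → (∀ j, j < t → InNth A s j v → j = i) →
        TakesEntry (row F n) v p i) ∧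
      ((¬ ∃! i, i < t ∧ InNth A s i v) → TakesEntry (row F n) v p t)

/-- `⟨V, X, A, F⟩` is a countable society in the structure `(M, 𝒮)`. -/
structure IsCountableSociety (𝒮 : Set (Set M)) (V X A F : Set M) : Prop where
  voters_mem : V ∈ 𝒮
  alternatives_mem : X ∈ 𝒮
  algebra_mem : A ∈ 𝒮
  profiles_mem : F ∈ 𝒮
  voters_nonempty : V.Nonempty
  alternatives_finite : IsFinite X
  three_alternatives : ∃ x ∈ X, ∃ y ∈ X, ∃ z ∈ X, x ≠ y ∧ x ≠ z ∧ y ≠ z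
  algebra : IsCountableAlgebra V A
  atomic : IsAtomic V A
  profiles : IsProfileSeq V X F
  measurable : UniformlyMeasurable 𝒮 V X A F
  embedded : QuasiPartitionEmbedded 𝒮 V X A F

/-! ### Social welfare functions -/

/-- `σ : ℕ → W`, an element of `𝒮`, is a social welfare function for `⟨V, X, A, F⟩`. -/
structure IsSocialWelfareFunction (𝒮 : Set (Set M)) (V X F σ : Set M) : Prop where
  mem : σ ∈ 𝒮
  isFun : IsFun σ Set.univ (weakOrders X)
  unanimity : ∀ x ∈ X, ∀ y ∈ X, ∀ i,
    (∀ v ∈ V, PrefLT (row F i) v x y) → PrefLT σ i x y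
  independence : ∀ x ∈ X, ∀ y ∈ X, ∀ i j,
    (∀ v ∈ V, ∀ a ∈ ({x, y} : Set M), ∀ b ∈ ({x, y} : Set M),
      (PrefLE (row F i) v a b ↔ PrefLE (row F j) v a b)) →
    ∀ a ∈ ({x, y} : Set M), ∀ b ∈ ({x, y} : Set M), (PrefLE σ i a b ↔ PrefLE σ j a b)

/-- `σ` is non-dictatorial. -/
def NonDictatorial (V X F σ : Set M) : Prop :=
  ∀ v ∈ V, ∃ i, ∃ x ∈ X, ∃ y ∈ X, PrefLT (row F i) v x y ∧ PrefLE σ i y x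

/-- `σ` is `k`-non-dictatorial: for every finite sequence `s` of voters of length at most `k` there
are a profile `f_j` and `x, y ∈ X` such that every voter in `s` strictly prefers `x` to `y`, and
society strictly prefers `y` to `x`. -/
def KNonDictatorial (V X F σ : Set M) (k : M) : Prop :=
  ∀ s l, IsSeq s l → (∀ i a, Entry s i a → a ∈ V) → l ≤ k →
    ∃ j, ∃ x ∈ X, ∃ y ∈ X,
      (∀ i a, Entry s i a → PrefLT (row F j) a x y) ∧ PrefLT σ j y x

/-- `σ` is finitely non-dictatorial. -/
def FinitelyNonDictatorial (V X F σ : Set M) : Prop :=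
  ∀ k : M, 1 ≤ k → KNonDictatorial V X F σ k

/-- `σ` has the cofinite coalitions property: if all but finitely many `v ∈ V` strictly prefer `x`
to `y`, then so does society. -/
def CofiniteCoalitions (V X F σ : Set M) : Prop :=
  ∀ j, ∀ x ∈ X, ∀ y ∈ X,
    IsFinite {v | v ∈ V ∧ ¬ PrefLT (row F j) v x y} → PrefLT σ j x y

end Coding

end RevMath

set_option linter.unusedSectionVars false

namespace RevMath

variable {M : Type*} [CommSemiring M] [LinearOrder M] [IsStrictOrderedRing M]
  [CanonicallyOrderedAdd M] {𝒮 : Set (Set M)}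

/-! ### Arithmetic in discretely ordered semirings -/

/-! Call a coalition defeated if, in some profile, its members all have x < y while society does
not. By Arrow's argument the complement of a defeated coalition is decisive, and decisive coalitions
are closed under intersection, so two defeated coalitions always lie in a common defeated one
(`exists_union_defeated`). If nobody dictates, every single voter lies in a defeated coalition, and
induction on `n` yields a profile in which all voters below `n` have x < y and society has y < x
(`NonDictatorial.exists_opposed`). This gives 3, because the voters in a finite sequence are below
its code, and 4, because finitely many dissenters are below a bound and the complement of a defeated
coalition is decisive. Back to 1 lead sequences of length one and a profile that splits {v} from the
other voters.

The rest makes this fit into RCA₀. Arrow's steps involve finitely many coalitions at a time, so they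
are carried out for arbitrary sets (`IsArrovian`). The model enters in producing profiles: the
quasi-partition embedding takes a permutation of `W`, so four given orders must be extended to an
enumeration of `W` (`exists_isPerm_extending`), which rests on Σ⁰₁ induction and on coding finite
sets by divisibility (`exists_code`). The induction on `n` is Σ⁰₁ because `W` is bounded. -/

theorem IsModelRCA₀.add_one_le (h : IsModelRCA₀ 𝒮) {a b : M} (hab : a < b) : a + 1 ≤ b := by
  obtain ⟨c, rfl⟩ := exists_add_of_le hab.le
  have hc : 0 < c := by
    rcases eq_or_lt_of_le (zero_le (a := c)) with h0 | h0
    · rw [← h0, add_zero] at hab; exact absurd hab (lt_irrefl _)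
    · exact h0
  gcongr
  exact h.discrete c hc

theorem IsModelRCA₀.lt_add_one_iff (h : IsModelRCA₀ 𝒮) {a b : M} : a < b + 1 ↔ a ≤ b := by
  refine ⟨fun hab => ?_, fun hab => lt_of_le_of_lt hab (lt_add_one b)⟩
  by_contra! hba
  exact absurd (h.add_one_le hba) (not_le.2 hab)

theorem IsModelRCA₀.lt_one_iff (h : IsModelRCA₀ 𝒮) {a : M} : a < 1 ↔ a = 0 := by
  rw [← zero_add (1 : M), h.lt_add_one_iff]
  exact nonpos_iff_eq_zero

theorem IsModelRCA₀.le_sq (h : IsModelRCA₀ 𝒮) (a : M) : a ≤ a ^ 2 := by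
  rcases eq_or_lt_of_le (zero_le (a := a)) with h0 | h0
  · rw [← h0]; simp
  · calc a = a * 1 := (mul_one a).symm
      _ ≤ a * a := by gcongr; exact h.discrete a h0
      _ = a ^ 2 := (sq a).symm

theorem le_pair_left (a b : M) : a ≤ pair a b := by
  unfold pair; exact le_add_self

theorem IsModelRCA₀.le_pair_right (h : IsModelRCA₀ 𝒮) (a b : M) : b ≤ pair a b := by
  unfold pair
  calc b ≤ a + b := le_add_self
    _ ≤ (a + b) ^ 2 := h.le_sq _
    _ ≤ _ := le_self_add

theorem pair_mono {a b c d : M} (hac : a ≤ c) (hbd : b ≤ d) : pair a b ≤ pair c d := by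
  unfold pair; gcongr

/-- The value lies between (a + b)² and (a + b + 1)², so pairs are ordered by their sums first. -/
theorem IsModelRCA₀.pair_lt_of_sum_lt (h : IsModelRCA₀ 𝒮) {a b c d : M} (hs : a + b < c + d) :
    pair a b < pair c d := by
  have h1 := h.add_one_le hs
  unfold pair
  calc (a + b) ^ 2 + a ≤ (a + b) ^ 2 + (a + b) := by gcongr; exact le_self_add
    _ ≤ (a + b) ^ 2 + (a + b) + (a + b) := le_self_add
    _ < (a + b) ^ 2 + (a + b) + (a + b) + 1 := lt_add_one _
    _ = (a + b + 1) ^ 2 := by ring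
    _ ≤ (c + d) ^ 2 := by gcongr
    _ ≤ _ := le_self_add

theorem IsModelRCA₀.pair_inj (h : IsModelRCA₀ 𝒮) {a b c d : M} :
    pair a b = pair c d ↔ a = c ∧ b = d := by
  refine ⟨fun hp => ?_, by rintro ⟨rfl, rfl⟩; rfl⟩
  rcases lt_trichotomy (a + b) (c + d) with hs | hs | hs
  · exact absurd hp (h.pair_lt_of_sum_lt hs).ne
  · unfold pair at hp
    rw [hs] at hp
    have hac := add_left_cancel hp
    subst hac
    exact ⟨rfl, add_left_cancel hs⟩
  · exact absurd hp (h.pair_lt_of_sum_lt hs).ne'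

/-- There is no subtraction, so the quotients are compared; if the quotient of the sum is not the
larger one, then `y = 0`. -/
theorem dvd_of_dvd_add {a x y : M} (hx : a ∣ x) (hxy : a ∣ x + y) : a ∣ y := by
  obtain ⟨p, rfl⟩ := hx
  obtain ⟨q, hq⟩ := hxy
  rcases le_total p q with hpq | hpq
  · obtain ⟨c, rfl⟩ := exists_add_of_le hpq
    rw [mul_add] at hq
    exact ⟨c, add_left_cancel hq⟩
  · have h1 : a * q ≤ a * p := by gcongr
    have h2 : a * p + y ≤ a * p + 0 := by rw [hq, add_zero]; exact h1
    have h3 : y ≤ 0 := by simpa using h2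
    rw [nonpos_iff_eq_zero.1 h3]
    exact dvd_zero a

/-- The moduli `m (i + 1) + 1`, `i < N`, are pairwise coprime if all of `1, …, N` divide `m`. -/
theorem IsModelRCA₀.dvd_of_dvd_mul_modulus (h : IsModelRCA₀ 𝒮) {N m i j w : M}
    (hm : ∀ i < N, (i + 1) ∣ m) (hi : i < N) (hj : j < N) (hij : i ≠ j)
    (hw : (m * (i + 1) + 1) ∣ w * (m * (j + 1) + 1)) : (m * (i + 1) + 1) ∣ w := by
  have key : ∀ {i j : M}, i < j → j < N → ∃ d, j = i + d ∧ d ∣ m := by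
    intro i j hlt hjN
    obtain ⟨d, rfl⟩ := exists_add_of_le (h.add_one_le hlt)
    refine ⟨1 + d, by ring, ?_⟩
    rw [add_comm]
    refine hm d (lt_of_le_of_lt ?_ hjN)
    exact le_add_self
  rcases lt_or_gt_of_ne hij with hlt | hlt
  -- Modulo u = m(i + 1) + 1 one has m(i + 1) ≡ -1, and the two moduli differ by m d. Hence u
  -- divides w m d, and multiplying by q (i + 1)² with d q = m turns this into w (m(i + 1))² ≡ w.
  -- The identities in both cases say this without subtraction.
  · obtain ⟨d, rfl, q, hq⟩ := key hlt hj
    obtain ⟨t, ht⟩ := hw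
    refine dvd_of_dvd_add (x := (m * (i + 1) + 1) *
      (w * q * (i + 1) ^ 2 + w * (m * (i + 1) + 1))) (dvd_mul_right _ _) ?_
    have : (m * (i + 1) + 1) * (w * q * (i + 1) ^ 2 + w * (m * (i + 1) + 1)) + w =
        (m * (i + 1) + 1) * (t * q * (i + 1) ^ 2 + 2 * w) := by
      calc _ = w * (m * (i + 1) + 1 + m * d) * q * (i + 1) ^ 2
            + 2 * w * (m * (i + 1) + 1) := by rw [hq]; ring
        _ = w * (m * (i + d + 1) + 1) * q * (i + 1) ^ 2 + 2 * w * (m * (i + 1) + 1) := by ring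
        _ = _ := by rw [ht]; ring
    rw [this]
    exact dvd_mul_right _ _
  · obtain ⟨d, hd, q, hq⟩ := key hlt hi
    obtain ⟨t, ht⟩ := hw
    have hu : (m * (i + 1) + 1) ∣ w * (m * (i + 1)) ^ 2 := by
      refine dvd_of_dvd_add (x := (m * (i + 1) + 1) * (t * q * (i + 1) ^ 2))
        (dvd_mul_right _ _) ?_
      have : (m * (i + 1) + 1) * (t * q * (i + 1) ^ 2) + w * (m * (i + 1)) ^ 2 =
          (m * (i + 1) + 1) * (q * (i + 1) ^ 2 * w) := by
        calc _ = (m * (i + 1) + 1) * t * (q * (i + 1) ^ 2) + w * (m * (i + 1)) ^ 2 := by ring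
          _ = w * (m * (j + 1) + 1) * (q * (i + 1) ^ 2) + w * (m * (d * q)) * (i + 1) ^ 2 := by
            rw [← ht, ← hq]; ring
          _ = (m * (j + d + 1) + 1) * (q * (i + 1) ^ 2 * w) := by ring
          _ = _ := by rw [← hd]
      rw [this]
      exact dvd_mul_right _ _
    refine dvd_of_dvd_add (x := w * (m * (i + 1) + 1) ^ 2)
      (Dvd.intro_left (w * (m * (i + 1) + 1)) (by ring)) ?_
    have : w * (m * (i + 1) + 1) ^ 2 + w =
        w * (m * (i + 1)) ^ 2 + (m * (i + 1) + 1) * (2 * w) := by ring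
    rw [this]
    exact dvd_add hu (dvd_mul_right _ _)

/-! ### Definability by terms and by bounded formulas -/

/-- `t` is the function of the assignment given by a number term. -/
def IsTerm (t : (ℕ → M) → M) : Prop := ∃ τ : NumTerm M, ∀ e, τ.val e = t e

namespace IsTerm

theorem var (i : ℕ) : IsTerm (fun e : ℕ → M => e i) := ⟨.var i, fun _ => rfl⟩

theorem param (a : M) : IsTerm (fun _ : ℕ → M => a) := ⟨.param a, fun _ => rfl⟩

theorem add {t s : (ℕ → M) → M} (ht : IsTerm t) (hs : IsTerm s) :
    IsTerm (fun e => t e + s e) := by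
  obtain ⟨τ, hτ⟩ := ht
  obtain ⟨ρ, hρ⟩ := hs
  exact ⟨.add τ ρ, fun e => by rw [NumTerm.val, hτ, hρ]⟩

theorem mul {t s : (ℕ → M) → M} (ht : IsTerm t) (hs : IsTerm s) :
    IsTerm (fun e => t e * s e) := by
  obtain ⟨τ, hτ⟩ := ht
  obtain ⟨ρ, hρ⟩ := hs
  exact ⟨.mul τ ρ, fun e => by rw [NumTerm.val, hτ, hρ]⟩

theorem pair {t s : (ℕ → M) → M} (ht : IsTerm t) (hs : IsTerm s) :
    IsTerm (fun e => RevMath.pair (t e) (s e)) := by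
  simp only [RevMath.pair, sq]
  exact ((ht.add hs).mul (ht.add hs)).add ht

theorem succ {t : (ℕ → M) → M} (ht : IsTerm t) : IsTerm (fun e => t e + 1) := ht.add (param 1)

/-- Weakening: needed whenever a term moves under one more bounded quantifier. -/
theorem shift {t : (ℕ → M) → M} (ht : IsTerm t) : IsTerm (fun e => t (fun i => e (i + 1))) := by
  obtain ⟨τ, hτ⟩ := ht
  suffices H : ∀ τ : NumTerm M, IsTerm (fun e => τ.val (fun i => e (i + 1))) by
    simpa only [hτ] using H τ
  intro τ
  induction τ with
  | var i => exact var (i + 1)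
  | param a => exact param a
  | add τ ρ h1 h2 => exact h1.add h2
  | mul τ ρ h1 h2 => exact h1.mul h2

end IsTerm

/-- `P` is the property of the assignment given by a bounded formula with parameters. -/
def BddDef (𝒮 : Set (Set M)) (P : (ℕ → M) → Prop) : Prop :=
  ∃ φ : BddFormula 𝒮, ∀ e, φ.Holds e ↔ P e

/-- `P` is a property of numbers given by a bounded formula with parameters. -/
def BddPred (𝒮 : Set (Set M)) (P : M → Prop) : Prop :=
  ∀ t, IsTerm t → BddDef 𝒮 (fun e => P (t e))

namespace BddDef

theorem congr {P Q : (ℕ → M) → Prop} (hP : BddDef 𝒮 P) (h : ∀ e, Q e ↔ P e) : BddDef 𝒮 Q := by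
  obtain ⟨φ, hφ⟩ := hP
  exact ⟨φ, fun e => (hφ e).trans (h e).symm⟩

theorem eq {t s : (ℕ → M) → M} (ht : IsTerm t) (hs : IsTerm s) :
    BddDef 𝒮 (fun e => t e = s e) := by
  obtain ⟨τ, hτ⟩ := ht
  obtain ⟨ρ, hρ⟩ := hs
  exact ⟨.eq τ ρ, fun e => by rw [BddFormula.Holds, hτ, hρ]⟩

theorem lt {t s : (ℕ → M) → M} (ht : IsTerm t) (hs : IsTerm s) :
    BddDef 𝒮 (fun e => t e < s e) := by
  obtain ⟨τ, hτ⟩ := ht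
  obtain ⟨ρ, hρ⟩ := hs
  exact ⟨.lt τ ρ, fun e => by rw [BddFormula.Holds, hτ, hρ]⟩

theorem mem {t : (ℕ → M) → M} {Y : Set M} (hY : Y ∈ 𝒮) (ht : IsTerm t) :
    BddDef 𝒮 (fun e => t e ∈ Y) := by
  obtain ⟨τ, hτ⟩ := ht
  exact ⟨.mem τ ⟨Y, hY⟩, fun e => by rw [BddFormula.Holds, hτ]⟩

theorem not {P : (ℕ → M) → Prop} (hP : BddDef 𝒮 P) : BddDef 𝒮 (fun e => ¬ P e) := by
  obtain ⟨φ, hφ⟩ := hP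
  exact ⟨.not φ, fun e => by rw [BddFormula.Holds, hφ]⟩

theorem and {P Q : (ℕ → M) → Prop} (hP : BddDef 𝒮 P) (hQ : BddDef 𝒮 Q) :
    BddDef 𝒮 (fun e => P e ∧ Q e) := by
  obtain ⟨φ, hφ⟩ := hP
  obtain ⟨ψ, hψ⟩ := hQ
  exact ⟨.and φ ψ, fun e => by rw [BddFormula.Holds, hφ, hψ]⟩

theorem or {P Q : (ℕ → M) → Prop} (hP : BddDef 𝒮 P) (hQ : BddDef 𝒮 Q) :
    BddDef 𝒮 (fun e => P e ∨ Q e) :=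
  (hP.not.and hQ.not).not.congr fun _ => by tauto

theorem imp {P Q : (ℕ → M) → Prop} (hP : BddDef 𝒮 P) (hQ : BddDef 𝒮 Q) :
    BddDef 𝒮 (fun e => P e → Q e) :=
  (hP.and hQ.not).not.congr fun _ => by tauto

theorem iff {P Q : (ℕ → M) → Prop} (hP : BddDef 𝒮 P) (hQ : BddDef 𝒮 Q) :
    BddDef 𝒮 (fun e => P e ↔ Q e) :=
  ((hP.imp hQ).and (hQ.imp hP)).congr fun _ => by tauto

/-- Only the truth value matters, so comparisons of standard ranks count as bounded formulas. -/
theorem const (p : Prop) : BddDef 𝒮 (fun _ => p) := by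
  by_cases hp : p
  · exact (eq (IsTerm.param 0) (IsTerm.param 0)).congr fun _ => by simp [hp]
  · exact (eq (IsTerm.param 0) (IsTerm.param 0)).not.congr fun _ => by simp [hp]

theorem ball {t : (ℕ → M) → M} {P : M → (ℕ → M) → Prop} (ht : IsTerm t)
    (hP : BddDef 𝒮 (fun e => P (e 0) (fun i => e (i + 1)))) :
    BddDef 𝒮 (fun e => ∀ a < t e, P a e) := by
  obtain ⟨τ, hτ⟩ := ht
  obtain ⟨φ, hφ⟩ := hP
  refine ⟨.ballLT τ φ, fun e => ?_⟩
  rw [BddFormula.Holds, hτ]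
  exact forall₂_congr fun a _ => hφ (cons a e)

theorem bex {t : (ℕ → M) → M} {P : M → (ℕ → M) → Prop} (ht : IsTerm t)
    (hP : BddDef 𝒮 (fun e => P (e 0) (fun i => e (i + 1)))) :
    BddDef 𝒮 (fun e => ∃ a < t e, P a e) :=
  (ball (P := fun a e => ¬ P a e) ht hP.not).not.congr fun _ => by push Not; rfl

end BddDef

/-! ### Induction and the least number principle -/

theorem IsModelRCA₀.sigma_induction (h : IsModelRCA₀ 𝒮) {P : M → M → Prop}
    (hP : BddDef 𝒮 (fun e => P (e 1) (e 0))) (h0 : ∃ k, P 0 k)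
    (hs : ∀ n, (∃ k, P n k) → ∃ k, P (n + 1) k) (n : M) : ∃ k, P n k := by
  obtain ⟨φ, hφ⟩ := hP
  have key : ∀ n k, φ.Holds₂ n k ↔ P n k := fun n k => hφ _
  simpa only [key] using h.sigma_one_induction φ (by simpa only [key] using h0)
    (by simpa only [key] using hs) n

theorem IsModelRCA₀.bdd_induction (h : IsModelRCA₀ 𝒮) {P : M → Prop} (hP : BddPred 𝒮 P)
    (h0 : P 0) (hs : ∀ n, P n → P (n + 1)) (n : M) : P n := by
  obtain ⟨_, hn⟩ := h.sigma_induction (P := fun n _ => P n) (hP _ (.var 1)) ⟨0, h0⟩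
    (fun n ⟨k, hk⟩ => ⟨k, hs n hk⟩) n
  exact hn

/-- The least number principle for bounded formulas. -/
theorem IsModelRCA₀.exists_least (h : IsModelRCA₀ 𝒮) {P : M → Prop} (hP : BddPred 𝒮 P) {a : M}
    (ha : P a) : ∃ c ≤ a, P c ∧ ∀ d < c, ¬ P d := by
  by_contra! hno
  have hall : ∀ n, ∀ d < n, d ≤ a → ¬ P d := by
    refine h.bdd_induction (P := fun n => ∀ d < n, d ≤ a → ¬ P d) ?_ ?_ ?_
    · intro t ht
      exact .ball ht (.imp ((BddDef.lt (.param a) (.var 0)).not.congr fun _ => not_lt.symm)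
        (hP _ (.var 0)).not)
    · intro d hd
      exact absurd hd (not_lt.2 zero_le)
    · intro n ih d hd hda hPd
      rcases eq_or_lt_of_le (h.lt_add_one_iff.1 hd) with rfl | hlt
      · obtain ⟨d', hd', hPd'⟩ := hno d hda hPd
        exact ih d' hd' (hd'.le.trans hda) hPd'
      · exact ih d hlt hda hPd
  exact hall (a + 1) a (lt_add_one a) le_rfl ha

end RevMath

namespace RevMath

variable {M : Type*} [CommSemiring M] [LinearOrder M] [IsStrictOrderedRing M]
  [CanonicallyOrderedAdd M] {𝒮 : Set (Set M)}

/-! ### Codes of finite sets -/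

theorem IsModelRCA₀.le_mul_of_ne_zero (h : IsModelRCA₀ 𝒮) {a : M} (ha : a ≠ 0) (q : M) :
    q ≤ a * q := by
  calc q = 1 * q := (one_mul q).symm
    _ ≤ a * q := by gcongr; exact h.discrete a (pos_iff_ne_zero.2 ha)

/-- The bound on the quotient makes divisibility a bounded formula; for `a = 0` the quotient is
arbitrary and is taken to be `0`. -/
theorem IsModelRCA₀.dvd_iff (h : IsModelRCA₀ 𝒮) {a b : M} :
    a ∣ b ↔ ∃ q < b + 1, b = a * q := by
  refine ⟨fun ⟨q, hq⟩ => ?_, fun ⟨q, _, hq⟩ => ⟨q, hq⟩⟩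
  by_cases ha : a = 0
  · subst ha
    exact ⟨0, h.lt_add_one_iff.2 zero_le, by rw [hq]; ring⟩
  · exact ⟨q, h.lt_add_one_iff.2 (hq ▸ h.le_mul_of_ne_zero ha q), hq⟩

theorem BddDef.dvd (h : IsModelRCA₀ 𝒮) {t s : (ℕ → M) → M} (ht : IsTerm t) (hs : IsTerm s) :
    BddDef 𝒮 (fun e => t e ∣ s e) :=
  (BddDef.bex (P := fun q e => s e = t e * q) hs.succ
    (.eq hs.shift (ht.shift.mul (.var 0)))).congr fun _ => h.dvd_iff

theorem IsModelRCA₀.inCode_iff (h : IsModelRCA₀ 𝒮) {i c : M} :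
    InCode i c ↔ ∃ k < c + 1, ∃ m < c + 1, ∃ n < c + 1,
      c = pair k (pair m n) ∧ i < k ∧ (m * (i + 1) + 1) ∣ n := by
  refine ⟨fun ⟨k, m, n, hc, hr⟩ => ?_, fun ⟨k, _, m, _, n, _, hr⟩ => ⟨k, m, n, hr⟩⟩
  refine ⟨k, h.lt_add_one_iff.2 ?_, m, h.lt_add_one_iff.2 ?_, n, h.lt_add_one_iff.2 ?_, hc, hr⟩
  · exact hc ▸ le_pair_left _ _
  · exact hc ▸ (le_pair_left m n).trans (h.le_pair_right _ _)
  · exact hc ▸ (h.le_pair_right m n).trans (h.le_pair_right _ _)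

theorem InCode.lt {i c : M} (hi : InCode i c) : i < c := by
  obtain ⟨k, m, n, rfl, hk, _⟩ := hi
  exact hk.trans_le (le_pair_left _ _)

theorem IsModelRCA₀.inCode_pair (h : IsModelRCA₀ 𝒮) {i k m n : M} :
    InCode i (pair k (pair m n)) ↔ i < k ∧ (m * (i + 1) + 1) ∣ n := by
  refine ⟨?_, fun hr => ⟨k, m, n, rfl, hr⟩⟩
  rintro ⟨k', m', n', hc, hr⟩
  obtain ⟨rfl, hmn⟩ := h.pair_inj.1 hc
  obtain ⟨rfl, rfl⟩ := h.pair_inj.1 hmn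
  exact hr

theorem BddDef.inCode (h : IsModelRCA₀ 𝒮) {t s : (ℕ → M) → M} (ht : IsTerm t) (hs : IsTerm s) :
    BddDef 𝒮 (fun e => InCode (t e) (s e)) :=
  (BddDef.bex (P := fun k e => ∃ m < s e + 1, ∃ n < s e + 1,
      s e = RevMath.pair k (RevMath.pair m n) ∧ t e < k ∧ (m * (t e + 1) + 1) ∣ n) hs.succ
    (.bex hs.shift.succ (.bex hs.shift.shift.succ
      (.and (.eq hs.shift.shift.shift (.pair (.var 2) (.pair (.var 1) (.var 0))))
        (.and (.lt ht.shift.shift.shift (.var 2))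
          (.dvd h (.succ (.mul (.var 1) ht.shift.shift.shift.succ)) (.var 0))))))).congr
    fun _ => h.inCode_iff

/-- Elements of a coded set are smaller than its code, so the sum of the codes bounds the
quantifier. -/
theorem BddDef.sameElements (h : IsModelRCA₀ 𝒮) {t s : (ℕ → M) → M} (ht : IsTerm t)
    (hs : IsTerm s) : BddDef 𝒮 (fun e => ∀ i, InCode i (t e) ↔ InCode i (s e)) := by
  refine (BddDef.ball (P := fun i e => InCode i (t e) ↔ InCode i (s e)) (ht.add hs)
    (.iff (.inCode h (.var 0) ht.shift) (.inCode h (.var 0) hs.shift))).congr fun e => ?_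
  refine ⟨fun hi i _ => hi i, fun hi i => ⟨fun hi' => (hi i ?_).1 hi', fun hi' => (hi i ?_).2 hi'⟩⟩
  · exact hi'.lt.trans_le le_self_add
  · exact hi'.lt.trans_le le_add_self

theorem BddPred.isFinCode (h : IsModelRCA₀ 𝒮) : BddPred 𝒮 (IsFinCode (M := M)) := fun _ ht =>
  .ball ht (.not (.sameElements h (.var 0) ht.shift))

theorem IsFinCode.ext {c d : M} (hc : IsFinCode c) (hd : IsFinCode d)
    (hcd : ∀ i, InCode i c ↔ InCode i d) : c = d := by
  rcases lt_trichotomy c d with hlt | heq | hlt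
  · exact absurd hcd (hd c hlt)
  · exact heq
  · exact absurd (fun i => (hcd i).symm) (hc d hlt)

theorem IsModelRCA₀.exists_isFinCode_le (h : IsModelRCA₀ 𝒮) (c : M) :
    ∃ d ≤ c, IsFinCode d ∧ ∀ i, InCode i d ↔ InCode i c := by
  obtain ⟨d, hdc, hd, hmin⟩ := h.exists_least (P := fun d => ∀ i, InCode i d ↔ InCode i c)
    (fun _ ht => .sameElements h ht (.param c)) (a := c) fun _ => Iff.rfl
  exact ⟨d, hdc, fun b hb hbd => hmin b hb fun i => (hbd i).trans (hd i), hd⟩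

/-- Existence of `T` is Σ⁰₁, so no product function has to be defined. With `m = 1`, `c = 0` this
replaces the factorial; with `c = 1` it gives a multiple of all the coding moduli. -/
theorem IsModelRCA₀.exists_common_multiple (h : IsModelRCA₀ 𝒮) {m : M} (hm : 0 < m) (c N : M) :
    ∃ T, 0 < T ∧ ∀ i < N, (m * (i + 1) + c) ∣ T := by
  refine h.sigma_induction (P := fun n T => 0 < T ∧ ∀ i < n, (m * (i + 1) + c) ∣ T)
    (.and (.lt (.param 0) (.var 0)) (.ball (.var 1)
      (.dvd h (.add (.mul (.param m) (.succ (.var 0))) (.param c)) (.var 1)))) ?_ ?_ N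
  · exact ⟨1, zero_lt_one, fun i hi => absurd hi (not_lt.2 zero_le)⟩
  · rintro n ⟨T, hT, hdvd⟩
    refine ⟨T * (m * (n + 1) + c), ?_, fun i hi => ?_⟩
    · have : 0 < n + 1 := lt_of_lt_of_le zero_lt_one le_add_self
      have : 0 < m * (n + 1) + c := lt_of_lt_of_le (mul_pos hm this) le_self_add
      exact mul_pos hT this
    · rcases eq_or_lt_of_le (h.lt_add_one_iff.1 hi) with rfl | hlt
      · exact dvd_mul_left _ _
      · exact (hdvd i hlt).mul_right _

/-- Bounded comprehension: all bounded definable subsets of `{i : i < N}` have a code below a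
bound that depends only on `N`. -/
theorem IsModelRCA₀.exists_code (h : IsModelRCA₀ 𝒮) (N : M) :
    ∃ B, ∀ Q : M → Prop, BddPred 𝒮 Q →
      ∃ c ≤ B, IsFinCode c ∧ ∀ i, InCode i c ↔ i < N ∧ Q i := by
  -- `m` is a multiple of 1, …, N, which makes the moduli coprime. `T` is a multiple of all of them,
  -- and bounds the least multiple chosen below for every `Q` at once.
  obtain ⟨m, hm0, hm⟩ := h.exists_common_multiple zero_lt_one 0 N
  simp only [one_mul, add_zero] at hm
  obtain ⟨T, hT0, hT⟩ := h.exists_common_multiple hm0 1 N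
  refine ⟨pair N (pair m T), fun Q hQ => ?_⟩
  -- The least positive common multiple of the wanted moduli is divisible by no other modulus: a
  -- superfluous one could be divided out, and by coprimality the wanted ones would still divide the
  -- quotient.
  obtain ⟨w, hwT, ⟨hw0, hw⟩, hmin⟩ := h.exists_least (a := T)
    (P := fun w => 0 < w ∧ ∀ i < N, Q i → (m * (i + 1) + 1) ∣ w)
    (fun _ ht => .and (.lt (.param 0) ht) (.ball (.param N) (.imp (hQ _ (.var 0))
      (.dvd h (.succ (.mul (.param m) (.succ (.var 0)))) ht.shift))))
    ⟨hT0, fun i hi _ => hT i hi⟩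
  obtain ⟨c, hcle, hc, hcw⟩ := h.exists_isFinCode_le (pair N (pair m w))
  refine ⟨c, hcle.trans (pair_mono le_rfl (pair_mono le_rfl hwT)), hc, fun j => ?_⟩
  rw [hcw, h.inCode_pair]
  refine and_congr_right fun hj => ⟨fun hdvd => ?_, fun hQj => hw j hj hQj⟩
  by_contra hQj
  obtain ⟨w', rfl⟩ := hdvd
  have hw'0 : 0 < w' := by
    rw [pos_iff_ne_zero]
    rintro rfl
    simp at hw0
  refine hmin w' ?_ ⟨hw'0, fun i hi hQi => ?_⟩
  · have h1 : 0 < m * (j + 1) * w' :=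
      mul_pos (mul_pos hm0 (lt_of_lt_of_le zero_lt_one le_add_self)) hw'0
    calc w' < m * (j + 1) * w' + w' := lt_add_of_pos_left _ h1
      _ = _ := by ring
  · refine h.dvd_of_dvd_mul_modulus hm hi hj (by rintro rfl; exact hQj hQi) ?_
    rw [mul_comm w']
    exact hw i hi hQi

/-- Codes are unique, so recoding the set through its own membership predicate recovers `c` below
the uniform bound. -/
theorem IsModelRCA₀.exists_code_bound (h : IsModelRCA₀ 𝒮) (N : M) :
    ∃ B, ∀ c : M, IsFinCode c → (∀ i, InCode i c → i < N) → c ≤ B := by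
  obtain ⟨B, hB⟩ := h.exists_code N
  refine ⟨B, fun c hc hcN => ?_⟩
  obtain ⟨d, hdB, hd, hdc⟩ := hB (fun i => InCode i c) fun _ ht => .inCode h ht (.param c)
  rwa [hc.ext hd fun i => by rw [hdc]; exact ⟨fun hi => ⟨hcN i hi, hi⟩, And.right⟩]

/-! ### Finite sequences -/

theorem Entry.lt_left {s i a : M} (hs : Entry s i a) : i < s :=
  (le_pair_left i a).trans_lt hs.lt

theorem IsModelRCA₀.entry_lt_right (h : IsModelRCA₀ 𝒮) {s i a : M} (hs : Entry s i a) : a < s :=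
  (h.le_pair_right i a).trans_lt hs.lt

theorem BddDef.entry (h : IsModelRCA₀ 𝒮) {t s r : (ℕ → M) → M} (ht : IsTerm t) (hs : IsTerm s)
    (hr : IsTerm r) : BddDef 𝒮 (fun e => Entry (t e) (s e) (r e)) :=
  .inCode h (hs.pair hr) ht

/-- A sequence given by a definable graph below a bound. -/
theorem IsModelRCA₀.exists_isSeq (h : IsModelRCA₀ 𝒮) {G : M → M → Prop} {l B : M}
    (hG : ∀ t s, IsTerm t → IsTerm s → BddDef 𝒮 (fun e => G (t e) (s e)))
    (hl : ∀ i a, G i a → i < l) (hB : ∀ i a, G i a → a < B) (hfun : ∀ i < l, ∃! a, G i a) :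
    ∃ s, IsSeq s l ∧ ∀ i a, Entry s i a ↔ G i a := by
  obtain ⟨_, hN⟩ := h.exists_code (pair l B)
  obtain ⟨s, -, hs, hsG⟩ := hN (fun c => ∃ i < l, ∃ a < B, c = pair i a ∧ G i a) fun t ht =>
    .bex (.param l) (.bex (.param B) (.and (.eq ht.shift.shift (.pair (.var 1) (.var 0)))
      (hG _ _ (.var 1) (.var 0))))
  have hE : ∀ i a, Entry s i a ↔ G i a := by
    intro i a
    rw [Entry, hsG]
    constructor
    · rintro ⟨-, i', -, a', -, hp, hG⟩
      obtain ⟨rfl, rfl⟩ := h.pair_inj.1 hp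
      exact hG
    · intro hia
      exact ⟨h.pair_lt_of_sum_lt (add_lt_add (hl i a hia) (hB i a hia)), i, hl i a hia, a,
        hB i a hia, rfl, hia⟩
  refine ⟨s, ⟨hs, ?_, ?_, ?_⟩, hE⟩
  · intro c hc
    obtain ⟨-, i, -, a, -, hp, -⟩ := (hsG c).1 hc
    exact ⟨i, a, hp⟩
  · intro i a b ha hb
    rw [hE] at ha hb
    exact (hfun i (hl i a ha)).unique ha hb
  · intro i
    simp only [hE]
    exact ⟨fun hi => (hfun i hi).exists, fun ⟨a, ha⟩ => hl i a ha⟩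

/-- The finite sequence `⟨a⟩`. -/
theorem IsModelRCA₀.exists_singleton_seq (h : IsModelRCA₀ 𝒮) (a : M) :
    ∃ s, IsSeq s 1 ∧ ∀ i b, Entry s i b ↔ i = 0 ∧ b = a :=
  h.exists_isSeq (G := fun i b => i = 0 ∧ b = a) (B := a + 1)
    (fun _ _ ht hs => .and (.eq ht (.param 0)) (.eq hs (.param a)))
    (fun _ _ hi => hi.1 ▸ zero_lt_one) (fun _ _ hi => hi.2 ▸ lt_add_one a)
    fun _ hi => ⟨a, ⟨h.lt_one_iff.1 hi, rfl⟩, fun _ hb => hb.2⟩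

theorem IsModelRCA₀.lt_three_iff (h : IsModelRCA₀ 𝒮) {i : M} :
    i < 1 + 1 + 1 ↔ i = 0 ∨ i = 1 ∨ i = 1 + 1 := by
  rw [h.lt_add_one_iff, le_iff_lt_or_eq, h.lt_add_one_iff, le_iff_lt_or_eq, h.lt_one_iff, or_assoc]

theorem two_three_ne : (1 + 1 : M) ≠ 0 ∧ (1 + 1 : M) ≠ 1 ∧ (1 + 1 + 1 : M) ≠ 0 ∧ (1 + 1 + 1 : M) ≠ 1 ∧
    (1 + 1 + 1 : M) ≠ 1 + 1 := by
  refine ⟨?_, ?_, ?_, ?_, ?_⟩ <;> norm_num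

/-- The finite sequence `⟨a₀, a₁, a₂, a₃⟩`. -/
theorem IsModelRCA₀.exists_seq_four (h : IsModelRCA₀ 𝒮) (a₀ a₁ a₂ a₃ : M) :
    ∃ s, IsSeq s (1 + 1 + 1 + 1) ∧ ∀ i b, Entry s i b ↔
      (i = 0 ∧ b = a₀) ∨ (i = 1 ∧ b = a₁) ∨ (i = 1 + 1 ∧ b = a₂) ∨ (i = 1 + 1 + 1 ∧ b = a₃) := by
  obtain ⟨h20, h21, h30, h31, h32⟩ := two_three_ne (M := M)
  have h10 := one_ne_zero (α := M)
  refine h.exists_isSeq (G := fun i b => (i = 0 ∧ b = a₀) ∨ (i = 1 ∧ b = a₁) ∨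
    (i = 1 + 1 ∧ b = a₂) ∨ (i = 1 + 1 + 1 ∧ b = a₃)) (B := a₀ + a₁ + a₂ + a₃ + 1)
    (fun _ _ ht hs => .or (.and (.eq ht (.param 0)) (.eq hs (.param a₀)))
      (.or (.and (.eq ht (.param 1)) (.eq hs (.param a₁)))
        (.or (.and (.eq ht (.param (1 + 1))) (.eq hs (.param a₂)))
          (.and (.eq ht (.param (1 + 1 + 1))) (.eq hs (.param a₃)))))) ?_ ?_ ?_
  · intro i a hi
    rw [h.lt_add_one_iff, le_iff_lt_or_eq, h.lt_three_iff]
    tauto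
  · intro _ a hi
    rw [h.lt_add_one_iff]
    rcases hi with ⟨-, rfl⟩ | ⟨-, rfl⟩ | ⟨-, rfl⟩ | ⟨-, rfl⟩
    · rw [add_assoc, add_assoc]; exact le_self_add
    · rw [add_assoc]; exact le_add_self.trans le_self_add
    · exact le_add_self.trans le_self_add
    · exact le_add_self
  · intro i hi
    rw [h.lt_add_one_iff, le_iff_lt_or_eq, h.lt_three_iff] at hi
    rcases hi with (rfl | rfl | rfl) | rfl
    · exact ⟨a₀, by simp, by rintro b hb; simpa [h10.symm, h20.symm, h30.symm] using hb⟩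
    · exact ⟨a₁, by simp, by rintro b hb; simpa [h10, h21.symm, h31.symm] using hb⟩
    · refine ⟨a₂, by simp, fun b hb => ?_⟩
      rcases hb with ⟨h', _⟩ | ⟨h', _⟩ | ⟨_, h'⟩ | ⟨h', _⟩
      · exact absurd h' h20
      · exact absurd h' h21
      · exact h'
      · exact absurd h'.symm h32
    · refine ⟨a₃, by simp, fun b hb => ?_⟩
      rcases hb with ⟨h', _⟩ | ⟨h', _⟩ | ⟨h', _⟩ | ⟨_, h'⟩
      · exact absurd h' h30
      · exact absurd h' h31
      · exact absurd h' h32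
      · exact h'

end RevMath

namespace RevMath

variable {M : Type*} [CommSemiring M] [LinearOrder M] [IsStrictOrderedRing M]
  [CanonicallyOrderedAdd M] {𝒮 : Set (Set M)}

/-! ### Enumerations of bounded definable sets -/

/-- `p` codes an injective sequence of elements of `W` of length `l` that extends `s` and in which
all elements of `W` below `n` occur. -/
structure IsPartialEnum (W : Set M) (s p l n : M) : Prop where
  mem : ∀ c, InCode c p → ∃ i < l, ∃ r ∈ W, c = pair i r
  total : ∀ i < l, ∃ r, Entry p i r
  inj : ∀ i j r r', Entry p i r → Entry p j r' → (i = j ↔ r = r')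
  exhaust : ∀ r < n, r ∈ W → ∃ i, Entry p i r
  extend : ∀ c, InCode c s → InCode c p

/-- Indices and entries are smaller than the code, so all quantifiers can be bounded. -/
theorem IsModelRCA₀.isPartialEnum_iff (h : IsModelRCA₀ 𝒮) {W : Set M} {s p l n : M} :
    IsPartialEnum W s p l n ↔
      (∀ c < p, InCode c p → ∃ i < l, ∃ r < p, r ∈ W ∧ c = pair i r) ∧
      (∀ i < l, ∃ r < p, Entry p i r) ∧
      (∀ i < p, ∀ j < p, ∀ r < p, ∀ r' < p, Entry p i r → Entry p j r' → (i = j ↔ r = r')) ∧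
      (∀ r < n, r ∈ W → ∃ i < p, Entry p i r) ∧
      ∀ c < s, InCode c s → InCode c p := by
  constructor
  · rintro ⟨h1, h2, h3, h4, h5⟩
    refine ⟨fun c _ hc => ?_, fun i hi => ?_, fun i _ j _ r _ r' _ => h3 i j r r', fun r hr hW => ?_,
      fun c _ => h5 c⟩
    · obtain ⟨i, hi, r, hr, rfl⟩ := h1 c hc
      exact ⟨i, hi, r, h.entry_lt_right hc, hr, rfl⟩
    · obtain ⟨r, hr⟩ := h2 i hi
      exact ⟨r, h.entry_lt_right hr, hr⟩
    · obtain ⟨i, hi⟩ := h4 r hr hW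
      exact ⟨i, hi.lt_left, hi⟩
  · rintro ⟨h1, h2, h3, h4, h5⟩
    refine ⟨fun c hc => ?_, fun i hi => ?_, fun i j r r' hi hj => ?_, fun r hr hW => ?_,
      fun c hc => h5 c hc.lt hc⟩
    · obtain ⟨i, hi, r, -, hr, rfl⟩ := h1 c hc.lt hc
      exact ⟨i, hi, r, hr, rfl⟩
    · obtain ⟨r, -, hr⟩ := h2 i hi
      exact ⟨r, hr⟩
    · exact h3 i hi.lt_left j hj.lt_left r (h.entry_lt_right hi) r' (h.entry_lt_right hj) hi hj
    · obtain ⟨i, -, hi⟩ := h4 r hr hW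
      exact ⟨i, hi⟩

theorem BddDef.isPartialEnum (h : IsModelRCA₀ 𝒮) {W : Set M} (hW : BddPred 𝒮 (· ∈ W)) (s : M)
    {t₁ t₂ t₃ : (ℕ → M) → M} (h₁ : IsTerm t₁) (h₂ : IsTerm t₂) (h₃ : IsTerm t₃) :
    BddDef 𝒮 (fun e => IsPartialEnum W s (t₁ e) (t₂ e) (t₃ e)) := by
  refine BddDef.congr ?_ fun _ => h.isPartialEnum_iff
  refine .and (.ball h₁ (.imp (.inCode h (.var 0) h₁.shift) (.bex h₂.shift (.bex h₁.shift.shift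
      (.and (hW _ (.var 0)) (.eq (.var 2) (.pair (.var 1) (.var 0)))))))) ?_
  refine .and (.ball h₂ (.bex h₁.shift (.entry h h₁.shift.shift (.var 1) (.var 0)))) ?_
  refine .and (.ball h₁ (.ball h₁.shift (.ball h₁.shift.shift (.ball h₁.shift.shift.shift
    (.imp (.entry h h₁.shift.shift.shift.shift (.var 3) (.var 1))
    (.imp (.entry h h₁.shift.shift.shift.shift (.var 2) (.var 0))
      (.iff (.eq (.var 3) (.var 2)) (.eq (.var 1) (.var 0))))))))) ?_
  exact .and (.ball h₃ (.imp (hW _ (.var 0)) (.bex h₁.shift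
      (.entry h h₁.shift.shift (.var 0) (.var 1)))))
    (.ball (.param s) (.imp (.inCode h (.var 0) (.param s)) (.inCode h (.var 0) h₁.shift)))

/-- If `n` is an element of `W` that does not occur yet, it is appended at position `l`; otherwise
nothing changes. Codes need not be least here. -/
theorem IsModelRCA₀.isPartialEnum_succ (h : IsModelRCA₀ 𝒮) {W : Set M} {s p l n : M}
    (hp : IsPartialEnum W s p l n) : ∃ p' l', IsPartialEnum W s p' l' (n + 1) := by
  by_cases hn : n ∈ W ∧ ∀ i, ¬ Entry p i n
  · obtain ⟨hnW, hnew⟩ := hn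
    obtain ⟨_, hN⟩ := h.exists_code (p + pair l n + 1)
    obtain ⟨p', -, -, hp'⟩ := hN (fun c => InCode c p ∨ c = pair l n) fun t ht =>
      .or (.inCode h ht (.param p)) (.eq ht (.param _))
    have hin : ∀ c, InCode c p' ↔ InCode c p ∨ c = pair l n := by
      refine fun c => (hp' c).trans ⟨And.right, fun hc => ⟨?_, hc⟩⟩
      rw [h.lt_add_one_iff]
      rcases hc with hc | rfl
      · exact hc.lt.le.trans le_self_add
      · exact le_add_self
    have hE : ∀ i r, Entry p' i r ↔ Entry p i r ∨ (i = l ∧ r = n) := fun i r => by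
      rw [Entry, hin, h.pair_inj, Entry]
    have hlt : ∀ {i r}, Entry p i r → i < l := fun {i r} hi => by
      obtain ⟨i', hi', r', -, hir⟩ := hp.mem _ hi
      rwa [(h.pair_inj.1 hir).1]
    refine ⟨p', l + 1, ⟨fun c hc => ?_, fun i hi => ?_, fun i j r r' hi hj => ?_,
      fun r hr hW => ?_, fun c hc => (hin c).2 (.inl (hp.extend c hc))⟩⟩
    · rcases (hin c).1 hc with hc | rfl
      · obtain ⟨i, hi, r, hr, hir⟩ := hp.mem c hc
        exact ⟨i, hi.trans (lt_add_one l), r, hr, hir⟩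
      · exact ⟨l, lt_add_one l, n, hnW, rfl⟩
    · rcases eq_or_lt_of_le (h.lt_add_one_iff.1 hi) with rfl | hlt
      · exact ⟨n, (hE _ _).2 (.inr ⟨rfl, rfl⟩)⟩
      · obtain ⟨r, hr⟩ := hp.total i hlt
        exact ⟨r, (hE _ _).2 (.inl hr)⟩
    · rw [hE] at hi hj
      rcases hi with hi | ⟨rfl, rfl⟩ <;> rcases hj with hj | ⟨rfl, rfl⟩
      · exact hp.inj i j r r' hi hj
      · exact ⟨fun hij => absurd (hlt hi) (hij ▸ lt_irrefl _), fun hrn => absurd (hrn ▸ hi) (hnew i)⟩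
      · exact ⟨fun hij => absurd (hlt hj) (hij ▸ lt_irrefl _), fun hrn => absurd (hrn ▸ hj) (hnew j)⟩
      · simp
    · rcases eq_or_lt_of_le (h.lt_add_one_iff.1 hr) with rfl | hlt
      · exact ⟨l, (hE _ _).2 (.inr ⟨rfl, rfl⟩)⟩
      · obtain ⟨i, hi⟩ := hp.exhaust r hlt hW
        exact ⟨i, (hE _ _).2 (.inl hi)⟩
  · refine ⟨p, l, hp.mem, hp.total, hp.inj, fun r hr hW => ?_, hp.extend⟩
    rcases eq_or_lt_of_le (h.lt_add_one_iff.1 hr) with rfl | hlt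
    · by_contra! hno
      exact hn ⟨hW, hno⟩
    · exact hp.exhaust r hlt hW

/-- Every injective sequence in a bounded definable set extends to an enumeration of this set. -/
theorem IsModelRCA₀.exists_isPerm_extending (h : IsModelRCA₀ 𝒮) {W : Set M}
    (hW : BddPred 𝒮 (· ∈ W)) (hWb : IsFinite W) {s l : M} (hs : IsSeq s l)
    (hsW : ∀ i r, Entry s i r → r ∈ W) (hinj : ∀ i j r, Entry s i r → Entry s j r → i = j) :
    ∃ p l', IsPerm W p l' ∧ ∀ i r, Entry s i r → Entry p i r := by
  obtain ⟨B, hB⟩ := hWb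
  have key : ∀ n, ∃ p l', IsPartialEnum W s p l' n := by
    intro n
    -- One unbounded witness `k` bounds both `p` and `l'`, as Σ⁰₁ induction requires.
    suffices H : ∃ k, ∃ p < k, ∃ l' < k, IsPartialEnum W s p l' n by
      obtain ⟨k, p, -, l', -, hp⟩ := H
      exact ⟨p, l', hp⟩
    refine h.sigma_induction (P := fun n k => ∃ p < k, ∃ l' < k, IsPartialEnum W s p l' n)
      (.bex (.var 0) (.bex (.var 1) (.isPartialEnum h hW s (.var 1) (.var 0) (.var 3)))) ?_ ?_ n
    · refine ⟨s + l + 1, s, h.lt_add_one_iff.2 le_self_add, l, h.lt_add_one_iff.2 le_add_self,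
        fun c hc => ?_, fun i => (hs.2.2.2 i).1, fun i j r r' hi hj => ⟨?_, ?_⟩,
        fun r hr => absurd hr (not_lt.2 zero_le), fun _ => id⟩
      · obtain ⟨i, a, rfl⟩ := hs.2.1 c hc
        exact ⟨i, (hs.2.2.2 i).2 ⟨a, hc⟩, a, hsW i a hc, rfl⟩
      · rintro rfl
        exact hs.2.2.1 i r r' hi hj
      · rintro rfl
        exact hinj i j r hi hj
    · rintro n ⟨_, p, -, l', -, hp⟩
      obtain ⟨p', l'', hp'⟩ := h.isPartialEnum_succ hp
      exact ⟨p' + l'' + 1, p', h.lt_add_one_iff.2 le_self_add, l'', h.lt_add_one_iff.2 le_add_self,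
        hp'⟩
  obtain ⟨p₀, l', hp₀⟩ := key B
  -- Only now is the code replaced by the least one, as a sequence requires.
  obtain ⟨p, -, hp, hpp₀⟩ := h.exists_isFinCode_le p₀
  have hE : ∀ i r, Entry p i r ↔ Entry p₀ i r := fun i r => hpp₀ _
  have hmem : ∀ i r, Entry p i r → i < l' ∧ r ∈ W := by
    intro i r hir
    obtain ⟨i', hi', r', hr', hir'⟩ := hp₀.mem _ ((hE i r).1 hir)
    obtain ⟨rfl, rfl⟩ := h.pair_inj.1 hir'
    exact ⟨hi', hr'⟩
  refine ⟨p, l', ⟨⟨hp, fun c hc => ?_, fun i a b ha hb => ?_, fun i => ⟨fun hi => ?_, fun ⟨r, hr⟩ =>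
    (hmem i r hr).1⟩⟩, fun i r hr => (hmem i r hr).2, fun r hr => ?_⟩,
    fun i r hr => (hE i r).2 (hp₀.extend _ hr)⟩
  · obtain ⟨i, -, r, -, hir⟩ := hp₀.mem c ((hpp₀ c).1 hc)
    exact ⟨i, r, hir⟩
  · exact (hp₀.inj i i a b ((hE _ _).1 ha) ((hE _ _).1 hb)).1 rfl
  · obtain ⟨r, hr⟩ := hp₀.total i hi
    exact ⟨r, (hE i r).2 hr⟩
  · obtain ⟨i, hi⟩ := hp₀.exhaust r (hB r hr) hr
    exact ⟨i, (hE i r).2 hi, fun j hj => (hp₀.inj j i r r ((hE _ _).1 hj) hi).2 rfl⟩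

/-! ### Weak orders on a bounded set -/

theorem IsModelRCA₀.isFinite_weakOrders (h : IsModelRCA₀ 𝒮) {X : Set M} (hX : IsFinite X) :
    IsFinite (weakOrders X) := by
  obtain ⟨b, hb⟩ := hX
  obtain ⟨B, hB⟩ := h.exists_code_bound (pair b b)
  refine ⟨B + 1, fun r hr => h.lt_add_one_iff.2 (hB r hr.1 fun i hi => ?_)⟩
  obtain ⟨x, hx, y, hy, rfl⟩ := hr.2.1 i hi
  exact h.pair_lt_of_sum_lt (add_lt_add (hb x hx) (hb y hy))

theorem BddDef.codeLE (h : IsModelRCA₀ 𝒮) {t s r : (ℕ → M) → M} (ht : IsTerm t) (hs : IsTerm s)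
    (hr : IsTerm r) : BddDef 𝒮 (fun e => CodeLE (t e) (s e) (r e)) :=
  .inCode h (hs.pair hr) ht

theorem BddDef.codeLT (h : IsModelRCA₀ 𝒮) {t s r : (ℕ → M) → M} (ht : IsTerm t) (hs : IsTerm s)
    (hr : IsTerm r) : BddDef 𝒮 (fun e => CodeLT (t e) (s e) (r e)) :=
  .and (.codeLE h ht hs hr) (.not (.codeLE h ht hr hs))

theorem BddDef.forall_mem {X : Set M} (hX : X ∈ 𝒮) (hXb : IsFinite X) {P : M → (ℕ → M) → Prop}
    (hP : BddDef 𝒮 (fun e => P (e 0) (fun i => e (i + 1)))) :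
    BddDef 𝒮 (fun e => ∀ x ∈ X, P x e) := by
  obtain ⟨b, hb⟩ := hXb
  exact (BddDef.ball (P := fun x e => x ∈ X → P x e) (.param b) (.imp (.mem hX (.var 0)) hP)).congr
    fun e => ⟨fun hx x _ => hx x, fun hx x hxX => hx x (hb x hxX) hxX⟩

theorem BddDef.exists_mem {X : Set M} (hX : X ∈ 𝒮) (hXb : IsFinite X) {P : M → (ℕ → M) → Prop}
    (hP : BddDef 𝒮 (fun e => P (e 0) (fun i => e (i + 1)))) :
    BddDef 𝒮 (fun e => ∃ x ∈ X, P x e) :=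
  (BddDef.forall_mem (P := fun x e => ¬ P x e) hX hXb hP.not).not.congr fun _ => by push Not; rfl

theorem BddPred.weakOrders (h : IsModelRCA₀ 𝒮) {X : Set M} (hX : X ∈ 𝒮) (hXb : IsFinite X) :
    BddPred 𝒮 (· ∈ RevMath.weakOrders X) := by
  intro t ht
  refine .and (BddPred.isFinCode h t ht) (.and ?_ (.and ?_ ?_))
  · refine (BddDef.ball (P := fun c e => InCode c (t e) → ∃ x ∈ X, ∃ y ∈ X, c = RevMath.pair x y) ht
      (.imp (.inCode h (.var 0) ht.shift) (.exists_mem hX hXb (.exists_mem hX hXb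
        (.eq (.var 2) (.pair (.var 1) (.var 0))))))).congr fun e => ?_
    exact ⟨fun hc c _ => hc c, fun hc c hi => hc c hi.lt hi⟩
  · exact .forall_mem hX hXb (.forall_mem hX hXb (.forall_mem hX hXb
      (.imp (.codeLE h ht.shift.shift.shift (.var 2) (.var 1))
        (.imp (.codeLE h ht.shift.shift.shift (.var 1) (.var 0))
          (.codeLE h ht.shift.shift.shift (.var 2) (.var 0))))))
  · exact .forall_mem hX hXb (.forall_mem hX hXb (.or (.codeLE h ht.shift.shift (.var 1) (.var 0))
      (.codeLE h ht.shift.shift (.var 0) (.var 1))))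

/-- The rank function with values `a`, `b`, `c` at `x`, `y`, `z`, and `0` elsewhere. -/
def rankAt (x y z : M) (k : ℕ × ℕ × ℕ) (u : M) : ℕ :=
  if u = x then k.1 else if u = y then k.2.1 else if u = z then k.2.2 else 0

/-- Ranks are standard natural numbers and not elements of `M`; a case distinction on `x`, `y`, `z`
eliminates them. -/
theorem BddDef.rankAt (x y z : M) (k : ℕ × ℕ × ℕ) {t : (ℕ → M) → M} (ht : IsTerm t)
    {Q : ℕ → (ℕ → M) → Prop} (hQ : ∀ n, BddDef 𝒮 (Q n)) :
    BddDef 𝒮 (fun e => Q (rankAt x y z k (t e)) e) := by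
  have ite : ∀ (a : M) (f g : (ℕ → M) → ℕ), BddDef 𝒮 (fun e => Q (f e) e) →
      BddDef 𝒮 (fun e => Q (g e) e) →
      BddDef 𝒮 (fun e => Q (if t e = a then f e else g e) e) := fun a f g hf hg =>
    ((BddDef.imp (.eq ht (.param a)) hf).and (.imp (.not (.eq ht (.param a))) hg)).congr
      fun e => by split_ifs with hta <;> simp [hta]
  exact ite _ _ _ (hQ _) (ite _ _ _ (hQ _) (ite _ _ _ (hQ _) (hQ _)))

theorem IsModelRCA₀.exists_weakOrder_rankAt (h : IsModelRCA₀ 𝒮) {X : Set M} (hX : X ∈ 𝒮)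
    (hXb : IsFinite X) (x y z : M) (k : ℕ × ℕ × ℕ) :
    ∃ r ∈ weakOrders X, ∀ u ∈ X, ∀ v ∈ X, CodeLE r u v ↔ rankAt x y z k u ≤ rankAt x y z k v := by
  obtain ⟨b, hb⟩ := id hXb
  obtain ⟨_, hN⟩ := h.exists_code (pair b b)
  obtain ⟨r, -, hr, hrQ⟩ := hN (fun c => ∃ u ∈ X, ∃ v ∈ X, c = pair u v ∧
      rankAt x y z k u ≤ rankAt x y z k v) fun t ht =>
    .exists_mem hX hXb (.exists_mem hX hXb (.and (.eq ht.shift.shift (.pair (.var 1) (.var 0)))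
      (.rankAt (Q := fun m e => m ≤ rankAt x y z k (e 0)) x y z k (.var 1) fun m =>
        .rankAt (Q := fun m' _ => m ≤ m') x y z k (.var 0) fun _ => .const _)))
  have hle : ∀ u ∈ X, ∀ v ∈ X, CodeLE r u v ↔ rankAt x y z k u ≤ rankAt x y z k v := by
    intro u hu v hv
    rw [CodeLE, hrQ]
    constructor
    · rintro ⟨-, u', -, v', -, hp, hle⟩
      obtain ⟨rfl, rfl⟩ := h.pair_inj.1 hp
      exact hle
    · exact fun hle => ⟨h.pair_lt_of_sum_lt (add_lt_add (hb u hu) (hb v hv)), u, hu, v, hv, rfl, hle⟩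
  refine ⟨r, ⟨hr, fun c hc => ?_, fun u hu v hv w hw => ?_, fun u hu v hv => ?_⟩, hle⟩
  · obtain ⟨-, u, hu, v, hv, hc, -⟩ := (hrQ c).1 hc
    exact ⟨u, hu, v, hv, hc⟩
  · rw [hle u hu v hv, hle v hv w hw, hle u hu w hw]
    exact le_trans
  · rw [hle u hu v hv, hle v hv u hu]
    exact le_total _ _

end RevMath

namespace RevMath

/-! ### The ultrafilter of decisive coalitions -/

section Arrow

variable {ι N α : Type*}

/-- The asymmetric part of a relation. -/
def Strict (R : α → α → Prop) (x y : α) : Prop := R x y ∧ ¬ R y x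

/-- On `x`, `y`, `z`, the relation `R` compares the ranks given by `k`. -/
def HasRanks (R : α → α → Prop) (x y z : α) (k : ℕ × ℕ × ℕ) : Prop :=
  ((R x y ↔ k.1 ≤ k.2.1) ∧ (R y x ↔ k.2.1 ≤ k.1)) ∧
  ((R x z ↔ k.1 ≤ k.2.2) ∧ (R z x ↔ k.2.2 ≤ k.1)) ∧
  ((R y z ↔ k.2.1 ≤ k.2.2) ∧ (R z y ↔ k.2.2 ≤ k.2.1))

/-- The comparisons between three ranks. -/
def rankPattern (k : ℕ × ℕ × ℕ) : List Bool :=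
  [k.1 ≤ k.2.1, k.2.1 ≤ k.1, k.1 ≤ k.2.2, k.2.2 ≤ k.1, k.2.1 ≤ k.2.2, k.2.2 ≤ k.2.1]

/-- `S` aggregates the profiles `L j` as in Arrow's theorem; the domain of profiles is rich enough
to prescribe, on three alternatives, four distinct orders on four blocks of a partition. -/
structure IsArrovian (𝒜 : Set (Set N)) (L : ι → N → α → α → Prop) (S : ι → α → α → Prop) :
    Prop where
  inter : ∀ B ∈ 𝒜, ∀ C ∈ 𝒜, B ∩ C ∈ 𝒜
  compl : ∀ B ∈ 𝒜, Bᶜ ∈ 𝒜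
  measurable : ∀ j x y, {v | L j v x y} ∈ 𝒜
  total : ∀ j v x y, L j v x y ∨ L j v y x
  social_total : ∀ j x y, S j x y ∨ S j y x
  social_trans : ∀ j x y z, S j x y → S j y z → S j x z
  unanimity : ∀ j x y, (∀ v, Strict (L j v) x y) → Strict (S j) x y
  independence : ∀ i j x y, (∀ v, (L i v x y ↔ L j v x y) ∧ (L i v y x ↔ L j v y x)) →
    (S i x y ↔ S j x y) ∧ (S i y x ↔ S j y x)
  third : ∀ x y : α, ∃ z, z ≠ x ∧ z ≠ y
  realize : ∀ x y z : α, x ≠ y → x ≠ z → y ≠ z → ∀ B₀ ∈ 𝒜, ∀ B₁ ∈ 𝒜, ∀ B₂ ∈ 𝒜,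
    Disjoint B₀ B₁ → Disjoint B₀ B₂ → Disjoint B₁ B₂ → ∀ k₀ k₁ k₂ k₃ : ℕ × ℕ × ℕ,
    -- The orders become entries of a permutation of `W`, hence must be distinct.
    [rankPattern k₀, rankPattern k₁, rankPattern k₂, rankPattern k₃].Nodup →
    ∃ j, ∀ v, (v ∈ B₀ → HasRanks (L j v) x y z k₀) ∧ (v ∈ B₁ → HasRanks (L j v) x y z k₁) ∧
      (v ∈ B₂ → HasRanks (L j v) x y z k₂) ∧
      (v ∉ B₀ → v ∉ B₁ → v ∉ B₂ → HasRanks (L j v) x y z k₃)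

/-- The coalition `B` imposes its strict preference of `x` to `y`. -/
def Decisive (L : ι → N → α → α → Prop) (S : ι → α → α → Prop) (B : Set N) (x y : α) : Prop :=
  ∀ j, (∀ v ∈ B, Strict (L j v) x y) → Strict (S j) x y

/-- The coalition `B` imposes its strict preference of `x` to `y` against all other voters. -/
def AlmostDecisive (L : ι → N → α → α → Prop) (S : ι → α → α → Prop) (B : Set N) (x y : α) :
    Prop :=
  ∃ j, (∀ v ∈ B, Strict (L j v) x y) ∧ (∀ v ∉ B, Strict (L j v) y x) ∧ Strict (S j) x y

namespace IsArrovian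

variable {𝒜 : Set (Set N)} {L : ι → N → α → α → Prop} {S : ι → α → α → Prop}

theorem strict_trans (h : IsArrovian 𝒜 L S) {j : ι} {x y z : α} (hxy : Strict (S j) x y)
    (hyz : Strict (S j) y z) : Strict (S j) x z :=
  ⟨h.social_trans j _ _ _ hxy.1 hyz.1, fun hzx => hyz.2 (h.social_trans j _ _ _ hzx hxy.1)⟩

/-- By independence, one profile with this split settles all of them. -/
theorem strict_of_almostDecisive (h : IsArrovian 𝒜 L S) {B : Set N} {x y : α}
    (hB : AlmostDecisive L S B x y) {j : ι} (h1 : ∀ v ∈ B, Strict (L j v) x y)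
    (h2 : ∀ v ∉ B, Strict (L j v) y x) : Strict (S j) x y := by
  obtain ⟨i, hi1, hi2, hi⟩ := hB
  have := h.independence i j x y fun v => by
    by_cases hv : v ∈ B
    · have := h1 v hv; have := hi1 v hv; simp_all [Strict]
    · have := h2 v hv; have := hi2 v hv; simp_all [Strict]
  exact ⟨this.1.1 hi.1, fun hyx => hi.2 (this.2.2 hyx)⟩

theorem measurable_strict (h : IsArrovian 𝒜 L S) (j : ι) (x y : α) :
    {v | Strict (L j v) x y} ∈ 𝒜 :=
  h.inter _ (h.measurable j x y) _ (h.compl _ (h.measurable j y x))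

/-- Prescribes the order on `B` and, off `B`, one of three orders according to the preference
between `a` and `b` in the profile `i`. -/
theorem realize_relative (h : IsArrovian 𝒜 L S) {x y z : α} (hxy : x ≠ y) (hxz : x ≠ z)
    (hyz : y ≠ z) {B : Set N} (hB : B ∈ 𝒜) (i : ι) (a b : α) (k₀ k₁ k₂ k₃ : ℕ × ℕ × ℕ)
    (hk : [rankPattern k₀, rankPattern k₁, rankPattern k₂, rankPattern k₃].Nodup) :
    ∃ j, ∀ v, (v ∈ B → HasRanks (L j v) x y z k₀) ∧
      (v ∉ B → (L i v a b ∧ ¬ L i v b a ∧ HasRanks (L j v) x y z k₁) ∨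
        (L i v b a ∧ ¬ L i v a b ∧ HasRanks (L j v) x y z k₂) ∨
        (L i v a b ∧ L i v b a ∧ HasRanks (L j v) x y z k₃)) := by
  obtain ⟨j, hj⟩ := h.realize x y z hxy hxz hyz B hB
    (Bᶜ ∩ {v | Strict (L i v) a b}) (h.inter _ (h.compl _ hB) _ (h.measurable_strict i a b))
    (Bᶜ ∩ {v | Strict (L i v) b a}) (h.inter _ (h.compl _ hB) _ (h.measurable_strict i b a))
    (Set.disjoint_left.2 fun v hv hv' => hv'.1 hv) (Set.disjoint_left.2 fun v hv hv' => hv'.1 hv)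
    (Set.disjoint_left.2 fun v hv hv' => hv.2.2 hv'.2.1) k₀ k₁ k₂ k₃ hk
  refine ⟨j, fun v => ⟨(hj v).1, fun hv => ?_⟩⟩
  obtain ⟨-, h1, h2, h3⟩ := hj v
  simp only [Set.mem_inter_iff, Set.mem_compl_iff, Set.mem_ofPred_eq, Strict, hv,
    not_false_eq_true, true_and, forall_const] at h1 h2 h3
  have := h.total i v a b
  tauto

/-- Voters in `B` get x < y < z. All others get `y` strictly below `x` and `z`, with `x`, `z`
compared as in the profile `i`. Society has x < y because of `B` and y < z by unanimity; x < z is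
carried back to `i` by independence. -/
theorem decisive_right (h : IsArrovian 𝒜 L S) {B : Set N} (hB : B ∈ 𝒜) {x y z : α} (hxy : x ≠ y)
    (hxz : x ≠ z) (hyz : y ≠ z) (hD : AlmostDecisive L S B x y) : Decisive L S B x z := by
  intro i hi
  obtain ⟨j, hj⟩ := h.realize_relative hxy hxz hyz hB i x z
    (0, 1, 2) (1, 0, 2) (2, 0, 1) (1, 0, 1) (by decide)
  simp only [HasRanks] at hj
  norm_num at hj
  have h1 : Strict (S j) x y := h.strict_of_almostDecisive hD
    (fun v hv => by have := (hj v).1 hv; simp [Strict, this])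
    fun v hv => by have := (hj v).2 hv; grind [Strict]
  have h2 : Strict (S j) y z := h.unanimity j y z fun v => by
    have := hj v; grind [Strict]
  have h3 := h.strict_trans h1 h2
  have := h.independence i j x z fun v => by
    have h1 := hj v; have h2 := hi v; grind [Strict]
  grind [Strict]

/-- The mirror image: z < x < y on `B`; elsewhere `x` is strictly above `y` and `z`, which are
compared as in `i`. -/
theorem decisive_left (h : IsArrovian 𝒜 L S) {B : Set N} (hB : B ∈ 𝒜) {x y z : α} (hxy : x ≠ y)
    (hxz : x ≠ z) (hyz : y ≠ z) (hD : AlmostDecisive L S B x y) : Decisive L S B z y := by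
  intro i hi
  obtain ⟨j, hj⟩ := h.realize_relative hxy hxz hyz hB i z y
    (1, 2, 0) (2, 1, 0) (2, 0, 1) (1, 0, 0) (by decide)
  simp only [HasRanks] at hj
  norm_num at hj
  have h1 : Strict (S j) x y := h.strict_of_almostDecisive hD
    (fun v hv => by have := (hj v).1 hv; simp [Strict, this])
    fun v hv => by have := (hj v).2 hv; grind [Strict]
  have h2 : Strict (S j) z x := h.unanimity j z x fun v => by
    have := hj v; grind [Strict]
  have h3 := h.strict_trans h2 h1
  have := h.independence i j z y fun v => by
    have h1 := hj v; have h2 := hi v; grind [Strict]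
  grind [Strict]

theorem exists_split (h : IsArrovian 𝒜 L S) {B : Set N} (hB : B ∈ 𝒜) {x y : α} (hxy : x ≠ y) :
    ∃ j, (∀ v ∈ B, Strict (L j v) x y) ∧ ∀ v ∉ B, Strict (L j v) y x := by
  obtain ⟨z, hzx, hzy⟩ := h.third x y
  have h0 : (∅ : Set N) ∈ 𝒜 := by simpa using h.inter _ hB _ (h.compl _ hB)
  -- The second and third orders sit on empty blocks and only have to differ from the others.
  obtain ⟨j, hj⟩ := h.realize x y z hxy hzx.symm hzy.symm B hB ∅ h0 ∅ h0 (by simp) (by simp)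
    (by simp) (0, 1, 2) (0, 0, 0) (0, 0, 1) (1, 0, 2) (by decide)
  simp only [HasRanks] at hj
  norm_num at hj
  refine ⟨j, fun v hv => ?_, fun v hv => ?_⟩ <;> have := hj v <;> grind [Strict]

theorem almostDecisive_of_decisive (h : IsArrovian 𝒜 L S) {B : Set N} (hB : B ∈ 𝒜) {x y : α}
    (hxy : x ≠ y) (hD : Decisive L S B x y) : AlmostDecisive L S B x y := by
  obtain ⟨j, h1, h2⟩ := h.exists_split hB hxy
  exact ⟨j, h1, h2, hD j h1⟩

/-- Decisiveness spreads by changing one alternative at a time: from (x, y) through (x, z) and (a,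
z) to (a, b), with `z` different from `x` and `a`. -/
theorem decisive_of_almostDecisive (h : IsArrovian 𝒜 L S) {B : Set N} (hB : B ∈ 𝒜) {x y : α}
    (hxy : x ≠ y) (hD : AlmostDecisive L S B x y) {a b : α} (hab : a ≠ b) :
    Decisive L S B a b := by
  have right : ∀ {x y b : α}, x ≠ y → AlmostDecisive L S B x y → x ≠ b → Decisive L S B x b := by
    intro x y b hxy hD hxb
    obtain ⟨z, hzx, hzy⟩ := h.third x y
    by_cases hyb : y = b
    · subst hyb
      exact h.decisive_right hB hzx.symm hxy hzy
        (h.almostDecisive_of_decisive hB hzx.symm (h.decisive_right hB hxy hzx.symm hzy.symm hD))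
    · exact h.decisive_right hB hxy hxb hyb hD
  have left : ∀ {x y a : α}, x ≠ y → AlmostDecisive L S B x y → a ≠ y → Decisive L S B a y := by
    intro x y a hxy hD hay
    obtain ⟨z, hzx, hzy⟩ := h.third x y
    by_cases hxa : x = a
    · subst hxa
      exact h.decisive_left hB hzy hzx hay.symm
        (h.almostDecisive_of_decisive hB hzy (h.decisive_left hB hxy hzx.symm hzy.symm hD))
    · exact h.decisive_left hB hxy hxa hay.symm hD
  obtain ⟨z, hzx, hza⟩ := h.third x a
  have h1 := h.almostDecisive_of_decisive hB hzx.symm (right hxy hD hzx.symm)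
  have h2 := h.almostDecisive_of_decisive hB hza.symm (left hzx.symm h1 hza.symm)
  exact right hza.symm h2 hab

/-- Voters in `B` get x < z < y; all others get `z` strictly on top and keep their comparison of
`x`, `y`. Society has x < z by unanimity and y ≲ x as in `i`, hence y < z, which exactly the voters
outside `B` share. -/
theorem decisive_compl (h : IsArrovian 𝒜 L S) {B : Set N} (hB : B ∈ 𝒜) {i : ι} {x y : α}
    (hxy : x ≠ y) (hi : ∀ v ∈ B, Strict (L i v) x y) (hS : ¬ Strict (S i) x y) {a b : α}
    (hab : a ≠ b) : Decisive L S Bᶜ a b := by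
  obtain ⟨z, hzx, hzy⟩ := h.third x y
  obtain ⟨j, hj⟩ := h.realize_relative hxy hzx.symm hzy.symm hB i x y
    (0, 2, 1) (0, 1, 2) (1, 0, 2) (0, 0, 1) (by decide)
  simp only [HasRanks] at hj
  norm_num at hj
  have h1 : Strict (S j) x z := h.unanimity j x z fun v => by
    have := hj v; grind [Strict]
  have h2 : S j y x := by
    have := h.independence i j x y fun v => by
      have h1 := hj v; have h2 := hi v; grind [Strict]
    have := h.social_total i x y
    grind [Strict]
  have h3 : Strict (S j) y z := ⟨h.social_trans j _ _ _ h2 h1.1, fun hzy =>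
    h1.2 (h.social_trans j _ _ _ hzy h2)⟩
  refine h.decisive_of_almostDecisive (h.compl _ hB) hzy.symm ⟨j, fun v hv => ?_, fun v hv => ?_, h3⟩
    hab
  · have := hj v; rw [Set.mem_compl_iff] at hv; grind [Strict]
  · have := hj v; rw [Set.mem_compl_iff] at hv; grind [Strict]

/-- A Condorcet configuration: all of `B` has a < b and all of `C` has b < z, so society has a < z,
but z < a holds for every voter outside `B ∩ C`. -/
theorem decisive_inter (h : IsArrovian 𝒜 L S) {B C : Set N} (hB : B ∈ 𝒜) (hC : C ∈ 𝒜)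
    (hBD : ∀ a b, a ≠ b → Decisive L S B a b) (hCD : ∀ a b, a ≠ b → Decisive L S C a b) {a b : α}
    (hab : a ≠ b) : Decisive L S (B ∩ C) a b := by
  obtain ⟨z, hza, hzb⟩ := h.third a b
  obtain ⟨j, hj⟩ := h.realize a b z hab hza.symm hzb.symm (B ∩ C) (h.inter _ hB _ hC)
    (B ∩ Cᶜ) (h.inter _ hB _ (h.compl _ hC)) (C ∩ Bᶜ) (h.inter _ hC _ (h.compl _ hB))
    (Set.disjoint_left.2 fun v hv hv' => hv'.2 hv.2) (Set.disjoint_left.2 fun v hv hv' => hv'.2 hv.1)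
    (Set.disjoint_left.2 fun v hv hv' => hv.2 hv'.1)
    (0, 1, 2) (1, 2, 0) (2, 0, 1) (2, 1, 0) (by decide)
  simp only [HasRanks, Set.mem_inter_iff, Set.mem_compl_iff] at hj
  norm_num at hj
  have h1 : Strict (S j) a b := hBD a b hab j fun v hv => by
    have := hj v; grind [Strict]
  have h2 : Strict (S j) b z := hCD b z hzb.symm j fun v hv => by
    have := hj v; grind [Strict]
  refine h.decisive_of_almostDecisive (h.inter _ hB _ hC) hza.symm
    ⟨j, fun v hv => ?_, fun v hv => ?_, h.strict_trans h1 h2⟩ hab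
  · have := hj v; rw [Set.mem_inter_iff] at hv; grind [Strict]
  · have := hj v; rw [Set.mem_inter_iff] at hv; grind [Strict]

/-- Coalitions that can be defeated are closed under unions. -/
theorem exists_union_defeated (h : IsArrovian 𝒜 L S) {i j : ι} {x y x' y' : α} (hxy : x ≠ y)
    (hxy' : x' ≠ y') (hS : ¬ Strict (S i) x y) (hS' : ¬ Strict (S j) x' y') :
    ∃ k, (∀ v, Strict (L i v) x y ∨ Strict (L j v) x' y' → Strict (L k v) x y) ∧
      Strict (S k) y x := by
  have hB := h.measurable_strict i x y
  have hC := h.measurable_strict j x' y'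
  -- Both complements are decisive, hence so is their intersection. It imposes y < x on a profile in
  -- which all other voters have x < y.
  have hD := h.decisive_inter (h.compl _ hB) (h.compl _ hC)
    (fun a b hab => h.decisive_compl hB hxy (fun _ hv => hv) hS hab)
    (fun a b hab => h.decisive_compl hC hxy' (fun _ hv => hv) hS' hab) hxy.symm
  obtain ⟨k, h1, h2⟩ := h.exists_split (h.inter _ (h.compl _ hB) _ (h.compl _ hC)) hxy.symm
  exact ⟨k, fun v hv => h2 v fun hv' => hv.elim hv'.1 hv'.2, hD k h1⟩

end IsArrovian

end Arrow

end RevMath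

namespace RevMath

variable {M : Type*} [CommSemiring M] [LinearOrder M] [IsStrictOrderedRing M]
  [CanonicallyOrderedAdd M] {𝒮 : Set (Set M)} {V X A F σ : Set M}

/-! ### Preferences of voters and of society -/

theorem IsFun.mem_of_pair_mem (h : IsModelRCA₀ 𝒮) {f A B : Set M} (hf : IsFun f A B) {a r : M}
    (ha : pair a r ∈ f) : a ∈ A ∧ r ∈ B := by
  obtain ⟨a', ha', b', hb', hp⟩ := hf.1 _ ha
  obtain ⟨rfl, rfl⟩ := h.pair_inj.1 hp
  exact ⟨ha', hb'⟩

theorem IsFun.prefLE_iff (h : IsModelRCA₀ 𝒮) {f A B : Set M} (hf : IsFun f A B) {a r x y : M}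
    (ha : pair a r ∈ f) : PrefLE f a x y ↔ CodeLE r x y := by
  refine ⟨fun ⟨r', hr', hxy⟩ => ?_, fun hxy => ⟨r, ha, hxy⟩⟩
  rwa [(hf.2 a (hf.mem_of_pair_mem h ha).1).unique ha hr']

theorem IsFun.prefLT_iff (h : IsModelRCA₀ 𝒮) {f A B : Set M} (hf : IsFun f A B) {a x y : M}
    (ha : a ∈ A) : PrefLT f a x y ↔ Strict (PrefLE f a) x y := by
  obtain ⟨r, hr, -⟩ := hf.2 a ha
  rw [Strict, hf.prefLE_iff h hr, hf.prefLE_iff h hr]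
  refine ⟨fun ⟨r', hr', hxy⟩ => ?_, fun hxy => ⟨r, hr, hxy⟩⟩
  rwa [(hf.2 a ha).unique hr hr']

theorem IsFun.prefLE_total (h : IsModelRCA₀ 𝒮) {f A : Set M} (hf : IsFun f A (weakOrders X))
    {a x y : M} (ha : a ∈ A) (hx : x ∈ X) (hy : y ∈ X) : PrefLE f a x y ∨ PrefLE f a y x := by
  obtain ⟨r, hr, -⟩ := hf.2 a ha
  rw [hf.prefLE_iff h hr, hf.prefLE_iff h hr]
  exact (hf.mem_of_pair_mem h hr).2.2.2.2 x hx y hy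

theorem IsFun.prefLE_trans (h : IsModelRCA₀ 𝒮) {f A : Set M} (hf : IsFun f A (weakOrders X))
    {a x y z : M} (ha : a ∈ A) (hx : x ∈ X) (hy : y ∈ X) (hz : z ∈ X) (hxy : PrefLE f a x y)
    (hyz : PrefLE f a y z) : PrefLE f a x z := by
  obtain ⟨r, hr, -⟩ := hf.2 a ha
  rw [hf.prefLE_iff h hr] at *
  exact (hf.mem_of_pair_mem h hr).2.2.2.1 x hx y hy z hz hxy hyz

/-! ### Countable societies are Arrovian -/

/-- The coalitions that belong to the algebra `A`. -/
def coalitions (V A : Set M) : Set (Set V) := {B | ∃ k, ∀ v : V, v ∈ B ↔ (v : M) ∈ row A k}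

/-- Used contrapositively: different patterns come from different codes of orders. -/
theorem rankPattern_eq_of_hasRanks {α : Type*} {R : α → α → Prop} {x y z : α} {k k' : ℕ × ℕ × ℕ}
    (hk : HasRanks R x y z k) (hk' : HasRanks R x y z k') : rankPattern k = rankPattern k' := by
  obtain ⟨⟨h1, h2⟩, ⟨h3, h4⟩, h5, h6⟩ := hk
  obtain ⟨⟨g1, g2⟩, ⟨g3, g4⟩, g5, g6⟩ := hk'
  simp only [rankPattern, List.cons.injEq, decide_eq_decide, and_true]
  exact ⟨h1.symm.trans g1, h2.symm.trans g2, h3.symm.trans g3, h4.symm.trans g4, h5.symm.trans g5,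
    h6.symm.trans g6⟩

theorem IsModelRCA₀.exists_weakOrder_hasRanks (h : IsModelRCA₀ 𝒮) (hX : X ∈ 𝒮) (hXb : IsFinite X)
    {x y z : M} (hx : x ∈ X) (hy : y ∈ X) (hz : z ∈ X) (hxy : x ≠ y) (hxz : x ≠ z) (hyz : y ≠ z)
    (k : ℕ × ℕ × ℕ) : ∃ r ∈ weakOrders X, HasRanks (CodeLE r) x y z k := by
  obtain ⟨r, hr, hrk⟩ := h.exists_weakOrder_rankAt hX hXb x y z k
  refine ⟨r, hr, ?_⟩
  simp [HasRanks, hrk _ hx _ hy, hrk _ hy _ hx, hrk _ hx _ hz, hrk _ hz _ hx, hrk _ hy _ hz,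
    hrk _ hz _ hy, rankAt, hxy.symm, hxz.symm, hyz.symm]

/-- Four distinct weak orders can be prescribed on three disjoint coalitions and their common
complement. -/
theorem IsCountableSociety.exists_profile (h : IsModelRCA₀ 𝒮) (hsoc : IsCountableSociety 𝒮 V X A F)
    {r₀ r₁ r₂ r₃ : M} (h₀ : r₀ ∈ weakOrders X) (h₁ : r₁ ∈ weakOrders X) (h₂ : r₂ ∈ weakOrders X)
    (h₃ : r₃ ∈ weakOrders X) (hne : [r₀, r₁, r₂, r₃].Nodup) {b₀ b₁ b₂ : M}
    (h01 : Disjoint (row A b₀) (row A b₁)) (h02 : Disjoint (row A b₀) (row A b₂))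
    (h12 : Disjoint (row A b₁) (row A b₂)) :
    ∃ n, ∀ v ∈ V, (v ∈ row A b₀ → pair v r₀ ∈ row F n) ∧ (v ∈ row A b₁ → pair v r₁ ∈ row F n) ∧
      (v ∈ row A b₂ → pair v r₂ ∈ row F n) ∧
      (v ∉ row A b₀ → v ∉ row A b₁ → v ∉ row A b₂ → pair v r₃ ∈ row F n) := by
  obtain ⟨h20, h21, h30, h31, h32⟩ := two_three_ne (M := M)
  have h10 := one_ne_zero (α := M)
  obtain ⟨q, hq, hqE⟩ := h.exists_seq_four r₀ r₁ r₂ r₃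
  obtain ⟨p, l, hp, hpq⟩ := h.exists_isPerm_extending
    (.weakOrders h hsoc.alternatives_mem hsoc.alternatives_finite)
    (h.isFinite_weakOrders hsoc.alternatives_finite) hq
    (fun i r hr => by rcases (hqE i r).1 hr with ⟨-, rfl⟩ | ⟨-, rfl⟩ | ⟨-, rfl⟩ | ⟨-, rfl⟩ <;>
      assumption)
    (fun i j r hi hj => by
      rw [hqE] at hi hj
      simp only [List.nodup_cons, List.mem_cons, List.not_mem_nil, or_false, not_or] at hne
      rcases hi with ⟨rfl, rfl⟩ | ⟨rfl, rfl⟩ | ⟨rfl, rfl⟩ | ⟨rfl, rfl⟩ <;>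
      rcases hj with ⟨rfl, h'⟩ | ⟨rfl, h'⟩ | ⟨rfl, h'⟩ | ⟨rfl, h'⟩ <;> first | rfl | grind)
  have hp0 : Entry p 0 r₀ := hpq _ _ ((hqE _ _).2 (by simp))
  have hp1 : Entry p 1 r₁ := hpq _ _ ((hqE _ _).2 (by simp))
  have hp2 : Entry p (1 + 1) r₂ := hpq _ _ ((hqE _ _).2 (by simp))
  have hp3 : Entry p (1 + 1 + 1) r₃ := hpq _ _ ((hqE _ _).2 (by simp))
  -- The last entry of a quasi-partition is never consulted, since its position stands for the
  -- default order; `b₂` is a filler there.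
  obtain ⟨s, hs, hsE⟩ := h.exists_seq_four b₀ b₁ b₂ b₂
  have hl : (1 + 1 + 1 + 1 : M) ≤ l := h.add_one_le ((hp.1.2.2.2 _).2 ⟨_, hp3⟩)
  have hqp : IsPermQPart (weakOrders X) p s (1 + 1 + 1) := ⟨l, hp, hs, hl⟩
  obtain ⟨e, -, hefun, he⟩ := hsoc.embedded
  obtain ⟨n, hn, -⟩ := hefun.2 _ ⟨p, s, _, hqp, rfl⟩
  have takes : ∀ {v i r}, TakesEntry (row F n) v p i → Entry p i r → pair v r ∈ row F n := by
    rintro v i r ⟨r', hr', hv⟩ hr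
    rwa [hp.1.2.2.1 i r r' hr hr']
  have nth0 : ∀ v, InNth A s 0 v ↔ v ∈ row A b₀ := fun v => by
    simp [InNth, hsE, h20.symm, h30.symm]
  have nth1 : ∀ v, InNth A s 1 v ↔ v ∈ row A b₁ := fun v => by
    simp [InNth, hsE, h21.symm, h31.symm]
  have nth2 : ∀ v, InNth A s (1 + 1) v ↔ v ∈ row A b₂ := fun v => by
    simp only [InNth, hsE, h20, h21, h32.symm, false_and, true_and, false_or, or_false]
    simp
  refine ⟨n, fun v hv => ⟨fun hv0 => ?_, fun hv1 => ?_, fun hv2 => ?_, fun hn0 hn1 hn2 => ?_⟩⟩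
  · refine takes ((he p s _ n hqp hn v hv).1 0 (h.lt_three_iff.2 (by simp)) ((nth0 v).2 hv0)
      fun j hj hjv => ?_) hp0
    rcases h.lt_three_iff.1 hj with rfl | rfl | rfl
    · rfl
    · exact absurd ((nth1 v).1 hjv) (Set.disjoint_left.1 h01 hv0)
    · exact absurd ((nth2 v).1 hjv) (Set.disjoint_left.1 h02 hv0)
  · refine takes ((he p s _ n hqp hn v hv).1 1 (h.lt_three_iff.2 (by simp)) ((nth1 v).2 hv1)
      fun j hj hjv => ?_) hp1
    rcases h.lt_three_iff.1 hj with rfl | rfl | rfl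
    · exact absurd hv1 (Set.disjoint_left.1 h01 ((nth0 v).1 hjv))
    · rfl
    · exact absurd ((nth2 v).1 hjv) (Set.disjoint_left.1 h12 hv1)
  · refine takes ((he p s _ n hqp hn v hv).1 (1 + 1) (h.lt_three_iff.2 (by simp)) ((nth2 v).2 hv2)
      fun j hj hjv => ?_) hp2
    rcases h.lt_three_iff.1 hj with rfl | rfl | rfl
    · exact absurd hv2 (Set.disjoint_left.1 h02 ((nth0 v).1 hjv))
    · exact absurd hv2 (Set.disjoint_left.1 h12 ((nth1 v).1 hjv))
    · rfl
  · refine takes ((he p s _ n hqp hn v hv).2 ?_) hp3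
    rintro ⟨i, ⟨hi, hiv⟩, -⟩
    rcases h.lt_three_iff.1 hi with rfl | rfl | rfl
    · exact hn0 ((nth0 v).1 hiv)
    · exact hn1 ((nth1 v).1 hiv)
    · exact hn2 ((nth2 v).1 hiv)

/-- Voters and alternatives become subtypes, so that complements are relative to `V` and Arrow's
argument applies without reference to codes. -/
theorem IsCountableSociety.isArrovian (h : IsModelRCA₀ 𝒮) (hsoc : IsCountableSociety 𝒮 V X A F)
    (hσ : IsSocialWelfareFunction 𝒮 V X F σ) :
    IsArrovian (coalitions V A) (fun j (v : V) (x y : X) => PrefLE (row F j) v x y)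
      (fun j (x y : X) => PrefLE σ j x y) where
  inter := by
    rintro B ⟨b, hb⟩ C ⟨c, hc⟩
    obtain ⟨k, hk⟩ := hsoc.algebra.inter b c
    exact ⟨k, fun v => by rw [hk, Set.mem_inter_iff, Set.mem_inter_iff, hb, hc]⟩
  compl := by
    rintro B ⟨b, hb⟩
    obtain ⟨k, hk⟩ := hsoc.algebra.compl b
    exact ⟨k, fun v => by rw [hk, Set.mem_compl_iff, hb, Set.mem_sdiff]; simp⟩
  measurable := by
    intro j x y
    obtain ⟨μ, -, hμ, hμm⟩ := hsoc.measurable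
    obtain ⟨k, hk, -⟩ := hμ.2 _ ⟨j, x, x.2, y, y.2, rfl⟩
    exact ⟨k, fun v => hμm j x x.2 y y.2 v v.2 k hk⟩
  total j v x y := (hsoc.profiles j).prefLE_total h v.2 x.2 y.2
  social_total _ x y := hσ.isFun.prefLE_total h (Set.mem_univ _) x.2 y.2
  social_trans _ x y z := hσ.isFun.prefLE_trans h (Set.mem_univ _) x.2 y.2 z.2
  unanimity j x y hv := by
    refine (hσ.isFun.prefLT_iff h (Set.mem_univ _)).1 (hσ.unanimity x x.2 y y.2 j fun v hvV => ?_)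
    exact ((hsoc.profiles j).prefLT_iff h hvV).2 (hv ⟨v, hvV⟩)
  independence i j x y hv := by
    have := hσ.independence x x.2 y y.2 i j fun v hvV a ha b hb => by
      have hxx := (hsoc.profiles i).prefLE_total h hvV x.2 x.2
      have hyy := (hsoc.profiles i).prefLE_total h hvV y.2 y.2
      have gxx := (hsoc.profiles j).prefLE_total h hvV x.2 x.2
      have gyy := (hsoc.profiles j).prefLE_total h hvV y.2 y.2
      obtain ⟨h1, h2⟩ := hv ⟨v, hvV⟩
      rcases ha with rfl | rfl <;> rcases hb with rfl | rfl
      · exact iff_of_true (or_self_iff.1 hxx) (or_self_iff.1 gxx)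
      · exact h1
      · exact h2
      · exact iff_of_true (or_self_iff.1 hyy) (or_self_iff.1 gyy)
    exact ⟨this x (by simp) y (by simp), this y (by simp) x (by simp)⟩
  third x y := by
    obtain ⟨a, ha, b, hb, c, hc, hab, hac, hbc⟩ := hsoc.three_alternatives
    by_cases hax : a = x ∨ a = y
    · by_cases hbx : b = x ∨ b = y
      · exact ⟨⟨c, hc⟩, by grind⟩
      · exact ⟨⟨b, hb⟩, by grind⟩
    · exact ⟨⟨a, ha⟩, by grind⟩
  realize := by
    rintro ⟨x, hx⟩ ⟨y, hy⟩ ⟨z, hz⟩ hxy hxz hyz B₀ ⟨b₀, hb₀⟩ B₁ ⟨b₁, hb₁⟩ B₂ ⟨b₂, hb₂⟩ h01 h02 h12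
      k₀ k₁ k₂ k₃ hk
    simp only [ne_eq, Subtype.mk.injEq] at hxy hxz hyz
    have hord := h.exists_weakOrder_hasRanks hsoc.alternatives_mem hsoc.alternatives_finite
      hx hy hz hxy hxz hyz
    obtain ⟨r₀, hr₀, hR₀⟩ := hord k₀
    obtain ⟨r₁, hr₁, hR₁⟩ := hord k₁
    obtain ⟨r₂, hr₂, hR₂⟩ := hord k₂
    obtain ⟨r₃, hr₃, hR₃⟩ := hord k₃
    have hne : ∀ {r r' k k'}, HasRanks (CodeLE r) x y z k → HasRanks (CodeLE r') x y z k' →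
        rankPattern k ≠ rankPattern k' → r ≠ r' := by
      rintro r _ k k' hr hr' hkk rfl
      exact hkk (rankPattern_eq_of_hasRanks hr hr')
    have disj : ∀ {B C : Set V} {b c : M}, (∀ v : V, v ∈ B ↔ (v : M) ∈ row A b) →
        (∀ v : V, v ∈ C ↔ (v : M) ∈ row A c) → Disjoint B C → Disjoint (row A b) (row A c) := by
      intro B C b c hb hc hBC
      refine Set.disjoint_left.2 fun v hvb hvc => ?_
      have hvV := hsoc.algebra.subset b hvb
      exact Set.disjoint_left.1 hBC ((hb ⟨v, hvV⟩).2 hvb) ((hc ⟨v, hvV⟩).2 hvc)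
    obtain ⟨n, hn⟩ := hsoc.exists_profile h hr₀ hr₁ hr₂ hr₃
      (by
        simp only [List.nodup_cons, List.mem_cons, List.not_mem_nil, or_false, not_or,
          not_false_eq_true, List.nodup_nil, and_true] at hk ⊢
        obtain ⟨⟨h1, h2, h3⟩, ⟨h4, h5⟩, h6⟩ := hk
        exact ⟨⟨hne hR₀ hR₁ h1, hne hR₀ hR₂ h2, hne hR₀ hR₃ h3⟩,
          ⟨hne hR₁ hR₂ h4, hne hR₁ hR₃ h5⟩, hne hR₂ hR₃ h6⟩)
      (disj hb₀ hb₁ h01) (disj hb₀ hb₂ h02) (disj hb₁ hb₂ h12)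
    have ranks : ∀ {v : V} {r k}, HasRanks (CodeLE r) x y z k → pair (v : M) r ∈ row F n →
        HasRanks (fun a b : X => PrefLE (row F n) v a b) ⟨x, hx⟩ ⟨y, hy⟩ ⟨z, hz⟩ k := by
      intro v r k hr hv
      simpa only [HasRanks, (hsoc.profiles n).prefLE_iff h hv] using hr
    refine ⟨n, fun v => ?_⟩
    obtain ⟨h1, h2, h3, h4⟩ := hn v v.2
    rw [hb₀, hb₁, hb₂]
    exact ⟨fun hv => ranks hR₀ (h1 hv), fun hv => ranks hR₁ (h2 hv), fun hv => ranks hR₂ (h3 hv),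
      fun g1 g2 g3 => ranks hR₃ (h4 g1 g2 g3)⟩

/-! ### Non-dictatorial social welfare functions -/

/-- If `σ` is non-dictatorial, then society can oppose all voters below any bound. -/
theorem NonDictatorial.exists_opposed (h : IsModelRCA₀ 𝒮) (hsoc : IsCountableSociety 𝒮 V X A F)
    (hσ : IsSocialWelfareFunction 𝒮 V X F σ) (hnd : NonDictatorial V X F σ) (n : M) :
    ∃ j, ∃ x ∈ X, ∃ y ∈ X, (∀ v ∈ V, v < n → PrefLT (row F j) v x y) ∧ PrefLT σ j y x := by
  have hA := hsoc.isArrovian h hσ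
  have lt_iff : ∀ {j v x y}, v ∈ V →
      (PrefLT (row F j) v x y ↔ Strict (PrefLE (row F j) v) x y) := fun {j v x y} hv =>
    (hsoc.profiles j).prefLT_iff h hv
  have slt_iff : ∀ {j x y}, PrefLT σ j x y ↔ Strict (PrefLE σ j) x y :=
    hσ.isFun.prefLT_iff h (Set.mem_univ _)
  -- The single witness `k` bounds the profile, the alternatives and the codes of all orders
  -- involved, which makes the claim Σ⁰₁.
  let P : M → M → Prop := fun n k => ∃ j < k, ∃ x < k, ∃ y < k, (x ∈ X ∧ y ∈ X) ∧
    (∀ v < n, v ∈ V → ∃ r < k, pair v r ∈ row F j ∧ CodeLT r x y) ∧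
    ∃ r < k, pair j r ∈ σ ∧ CodeLT r y x
  have hP : BddDef 𝒮 (fun e => P (e 1) (e 0)) := by
    refine .bex (.var _) (.bex (.var _) (.bex (.var _) (.and (.and
      (.mem hsoc.alternatives_mem (.var 1)) (.mem hsoc.alternatives_mem (.var 0))) (.and ?_ ?_))))
    · refine .ball (.var 4) (.imp (.mem hsoc.voters_mem (.var 0)) (.bex (.var 4) (.and ?_
        (.codeLT h (.var 0) (.var 3) (.var 2)))))
      exact .mem hsoc.profiles_mem (.pair (.var 4) (.pair (.var 1) (.var 0)))
    · exact .bex (.var 3) (.and (.mem hσ.mem (.pair (.var 3) (.var 0)))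
        (.codeLT h (.var 0) (.var 1) (.var 2)))
  have collect : ∀ n j x y, x ∈ X → y ∈ X → (∀ v ∈ V, v < n → PrefLT (row F j) v x y) →
      PrefLT σ j y x → ∃ k, P n k := by
    intro n j x y hx hy hv hs
    -- A bound for `W` bounds the orders of all voters below `n` simultaneously, so no collection
    -- principle is needed.
    obtain ⟨B, hB⟩ := h.isFinite_weakOrders hsoc.alternatives_finite
    obtain ⟨r, hr, hrxy⟩ := hs
    refine ⟨j + x + y + B + 1, j, h.lt_add_one_iff.2 ?_, x, h.lt_add_one_iff.2 ?_, y,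
      h.lt_add_one_iff.2 ?_, ⟨hx, hy⟩, fun v hvn hvV => ?_, r, ?_, hr, hrxy⟩
    · rw [add_assoc, add_assoc]; exact le_self_add
    · rw [add_assoc]; exact le_add_self.trans le_self_add
    · exact le_add_self.trans le_self_add
    · obtain ⟨r', hr', hlt⟩ := hv v hvV hvn
      refine ⟨r', h.lt_add_one_iff.2 ?_, hr', hlt⟩
      exact (hB _ ((hsoc.profiles j).mem_of_pair_mem h hr').2).le.trans le_add_self
    · exact h.lt_add_one_iff.2 ((hB _ (hσ.isFun.mem_of_pair_mem h hr).2).le.trans le_add_self)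
  have release : ∀ n k, P n k → ∃ j, ∃ x ∈ X, ∃ y ∈ X,
      (∀ v ∈ V, v < n → PrefLT (row F j) v x y) ∧ PrefLT σ j y x := by
    rintro n k ⟨j, -, x, -, y, -, ⟨hx, hy⟩, hv, r, -, hr⟩
    refine ⟨j, x, hx, y, hy, fun v hvV hvn => ?_, r, hr⟩
    obtain ⟨r', -, hr'⟩ := hv v hvn hvV
    exact ⟨r', hr'⟩
  obtain ⟨k, hk⟩ : ∃ k, P n k := by
    refine h.sigma_induction hP ?_ ?_ n
    -- No voter is below `0`, so a profile in which y < x is unanimous will do.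
    · obtain ⟨x, hx, y, hy, -, -, hxy, -, -⟩ := hsoc.three_alternatives
      obtain ⟨k, hk⟩ := hsoc.algebra.whole
      obtain ⟨j, hj, -⟩ := hA.exists_split (B := Set.univ) (x := ⟨y, hy⟩) (y := ⟨x, hx⟩)
        ⟨k, fun v => by simp [hk]⟩ (by simpa using hxy.symm)
      refine collect 0 j x y hx hy (fun v _ hv => absurd hv (not_lt.2 zero_le))
        (hσ.unanimity y hy x hx j fun v hv => (lt_iff hv).2 (hj ⟨v, hv⟩ (Set.mem_univ _)))
    · rintro n ⟨k, hk⟩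
      obtain ⟨i, x, hx, y, hy, hv, hs⟩ := release n k hk
      by_cases hnV : n ∈ V
      -- The voter `n` lies in a coalition defeated in `j`; it is merged with the one defeated in
      -- `i`.
      · obtain ⟨j, x', hx', y', hy', hn, hs'⟩ := hnd n hnV
        rw [slt_iff] at hs
        rw [lt_iff hnV] at hn
        have hxy : x ≠ y := by rintro rfl; exact hs.2 hs.1
        have hxy' : x' ≠ y' := by rintro rfl; exact hn.2 hn.1
        obtain ⟨m, hm, hms⟩ := hA.exists_union_defeated (i := i) (j := j) (x := ⟨x, hx⟩)
          (y := ⟨y, hy⟩) (x' := ⟨x', hx'⟩) (y' := ⟨y', hy'⟩) (by simpa using hxy)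
          (by simpa using hxy') (fun hc => hs.2 hc.1) (fun hc => hc.2 hs')
        refine collect (n + 1) m x y hx hy (fun v hvV hvn => (lt_iff hvV).2 (hm ⟨v, hvV⟩ ?_))
          (slt_iff.2 hms)
        rcases eq_or_lt_of_le (h.lt_add_one_iff.1 hvn) with rfl | hlt
        · exact .inr hn
        · exact .inl ((lt_iff hvV).1 (hv v hvV hlt))
      · refine collect (n + 1) i x y hx hy (fun v hvV hvn => hv v hvV ?_) hs
        refine lt_of_le_of_ne (h.lt_add_one_iff.1 hvn) ?_
        rintro rfl
        exact hnV hvV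
  exact release n k hk

/-- All voters in a sequence are smaller than its code, so it suffices to oppose the voters below
`s`. -/
theorem NonDictatorial.finitelyNonDictatorial (h : IsModelRCA₀ 𝒮)
    (hsoc : IsCountableSociety 𝒮 V X A F) (hσ : IsSocialWelfareFunction 𝒮 V X F σ)
    (hnd : NonDictatorial V X F σ) : FinitelyNonDictatorial V X F σ := by
  intro k _ s l _ hsV _
  obtain ⟨j, x, hx, y, hy, hv, hs⟩ := hnd.exists_opposed h hsoc hσ s
  exact ⟨j, x, hx, y, hy, fun i a ha => hv a (hsV i a ha) (h.entry_lt_right ha), hs⟩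

theorem KNonDictatorial.nonDictatorial (h : IsModelRCA₀ 𝒮)
    (hσ : IsSocialWelfareFunction 𝒮 V X F σ) {k : M} (hk : 1 ≤ k)
    (hnd : KNonDictatorial V X F σ k) : NonDictatorial V X F σ := by
  intro v hv
  obtain ⟨s, hs, hsE⟩ := h.exists_singleton_seq v
  obtain ⟨j, x, hx, y, hy, hlt, hgt⟩ := hnd s 1 hs
    (fun i a ha => by rw [((hsE i a).1 ha).2]; exact hv) hk
  exact ⟨j, x, hx, y, hy, hlt 0 v ((hsE 0 v).2 ⟨rfl, rfl⟩),
    ((hσ.isFun.prefLT_iff h (Set.mem_univ _)).1 hgt).1⟩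

/-- Dissenters are below `b`, and society opposes some profile in which all voters below `b` have x'
< y'. The complement of the coalition with x' < y' is therefore decisive, and its members all have x
< y in `i`. -/
theorem NonDictatorial.cofiniteCoalitions (h : IsModelRCA₀ 𝒮)
    (hsoc : IsCountableSociety 𝒮 V X A F) (hσ : IsSocialWelfareFunction 𝒮 V X F σ)
    (hnd : NonDictatorial V X F σ) : CofiniteCoalitions V X F σ := by
  have hA := hsoc.isArrovian h hσ
  rintro i x hx y hy ⟨b, hb⟩
  obtain ⟨j, x', hx', y', hy', hv, hs⟩ := hnd.exists_opposed h hsoc hσ b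
  rw [hσ.isFun.prefLT_iff h (Set.mem_univ _)] at hs
  have hxy' : x' ≠ y' := by rintro rfl; exact hs.2 hs.1
  have hout : ∀ v ∈ V, ¬ Strict (PrefLE (row F j) v) x' y' → Strict (PrefLE (row F i) v) x y := by
    intro v hvV hvj
    rw [← (hsoc.profiles _).prefLT_iff h hvV] at hvj ⊢
    by_contra hvi
    exact hvj (hv v hvV (hb v ⟨hvV, hvi⟩))
  -- If x = y, nobody has x < y, so x' < y' would be unanimous in `j`, against the social
  -- preference.
  have hxy : x ≠ y := by
    rintro rfl
    have := hA.unanimity j ⟨x', hx'⟩ ⟨y', hy'⟩ fun v => by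
      by_contra hvj
      have := hout v v.2 hvj
      exact this.2 this.1
    exact hs.2 this.1
  refine (hσ.isFun.prefLT_iff h (Set.mem_univ _)).2 ?_
  exact hA.decisive_compl (hA.measurable_strict j ⟨x', hx'⟩ ⟨y', hy'⟩) (by simpa using hxy')
    (fun v hv => hv) (fun hc => hs.2 hc.1) (a := ⟨x, hx⟩) (b := ⟨y, hy⟩) (by simpa using hxy) i
    fun v hv => hout v v.2 hv

/-- Atomicity yields a profile in which `v` alone has x < y and all others have y < x; the
exceptional set {v} is bounded by `v + 1`, so society sides against `v`. -/
theorem CofiniteCoalitions.nonDictatorial (h : IsModelRCA₀ 𝒮)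
    (hsoc : IsCountableSociety 𝒮 V X A F) (hσ : IsSocialWelfareFunction 𝒮 V X F σ)
    (hc : CofiniteCoalitions V X F σ) : NonDictatorial V X F σ := by
  have hA := hsoc.isArrovian h hσ
  intro v hv
  obtain ⟨x, hx, y, hy, -, -, hxy, -, -⟩ := hsoc.three_alternatives
  obtain ⟨k, hk⟩ := hsoc.atomic v hv
  obtain ⟨j, h1, h2⟩ := hA.exists_split (B := {⟨v, hv⟩}) (x := ⟨x, hx⟩) (y := ⟨y, hy⟩)
    ⟨k, fun w => by simp [hk, Subtype.ext_iff]⟩ (by simpa using hxy)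
  have lt_iff : ∀ {w x y}, w ∈ V →
      (PrefLT (row F j) w x y ↔ Strict (PrefLE (row F j) w) x y) := fun {w x y} hw =>
    (hsoc.profiles j).prefLT_iff h hw
  refine ⟨j, x, hx, y, hy, (lt_iff hv).2 (h1 ⟨v, hv⟩ rfl), ?_⟩
  refine ((hσ.isFun.prefLT_iff h (Set.mem_univ _)).1 (hc j y hy x hx ⟨v + 1, ?_⟩)).1
  rintro w ⟨hwV, hw⟩
  have : w = v := by
    by_contra hne
    exact hw ((lt_iff hwV).2 (h2 ⟨w, hwV⟩ (by simpa using hne)))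
  exact this ▸ lt_add_one w

end RevMath

theorem lemma5p2 {M : Type*} [CommSemiring M] [LinearOrder M] [IsStrictOrderedRing M]
    [CanonicallyOrderedAdd M] (𝒮 : Set (Set M)) (hRCA : RevMath.IsModelRCA₀ 𝒮)
    (V X A F : Set M) (hsoc : RevMath.IsCountableSociety 𝒮 V X A F)
    (σ : Set M) (hσ : RevMath.IsSocialWelfareFunction 𝒮 V X F σ) :
    List.TFAE
      [RevMath.NonDictatorial V X F σ,
        ∃ k : M, 1 ≤ k ∧ RevMath.KNonDictatorial V X F σ k,
        RevMath.FinitelyNonDictatorial V X F σ,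
        RevMath.CofiniteCoalitions V X F σ] := by
  tfae_have 1 → 3 := fun hnd => hnd.finitelyNonDictatorial hRCA hsoc hσ
  tfae_have 3 → 2 := fun hnd => ⟨1, le_rfl, hnd 1 le_rfl⟩
  tfae_have 2 → 1 := fun ⟨_, hk, hnd⟩ => hnd.nonDictatorial hRCA hσ hk
  tfae_have 1 → 4 := fun hnd => hnd.cofiniteCoalitions hRCA hsoc hσ
  tfae_have 4 → 1 := fun hc => hc.nonDictatorial hRCA hsoc hσ
  tfae_finish
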